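/- Let $\mathcal L$ be a finite relational language and let $T_\forall$ be a universal $\mathcal L$-theory such that the class of finite models of $T_\forall$ is a Fraïssé class with the strong amalgamation property: any embeddings $A\to B$, $A\to C$ in the class can be completed to a commutative square of embeddings $g_1:B\to D$, $g_2:C\to D$ in the class such that $g_1(B)\cap g_2(C)$ is exactly the image of $A$, and any two members embed into a third one with disjoint images. Let $T$ be the model completion of $T_\forall$. A meet-tree is a partial order in which every set $\{y : y\le x\}$ is linearly ordered and any two elements $x,y$ have a greatest common lower bound $x\wedge y$. Let $\mathcal L^*$ consist of $\le$, the binary function symbol $\wedge$, and an $(n+1)$-ary relation symbol $R^*$ for every $n$-ary $R\in\mathcal L$. Let $T^*_\forall$ be the universal $\mathcal L^*$-theory consisting of - the axioms of meet-trees; - for every $n$-ary $R\in\mathcal L$, the axioms $$\forall x,y,y'\ \Bigl(R^*(x,y_0,\dots,y_{n-1})\ \&\ \bigwedge_{i<n} x<y_i\wedge y_i'\ \to\ R^*(x,y'_0,\dots,y'_{n-1})\Bigr),$$ $$\forall x,y\ \Bigl(R^*(x,y_0,\dots,y_{n-1})\to \bigwedge_{i<n} x<y_i\Bigr);$$ -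 for every axiom $\forall y\,\psi(y)$ of $T_\forall$, with $\psi$ quantifier-free, the axiom $\forall x,y\,(x<y\to\psi^*(x,y))$, where $x<y$ means that $x$ is smaller than every entry of $y$, and $\psi^*(x,y)$ is obtained from $\psi(y)$ by replacing every $R(\dots)$ by $R^*(x,\dots)$ and every equality $u=u'$ by $x<u\wedge u'$. (So the models of $T^*_\forall$ are the meet-trees with a model of $T_\forall$ on the set of open cones of every center.) Let $T^*$ be the complete theory of the Fraïssé limit of the class of finite models of $T^*_\forall$, i.e. of the countable ultrahomogeneous structure whose age is this class. Then $T^*$ is NIP if and only if $T$ is NIP. Moreover, when $T$ is NIP, $T^*$ has finite dp-rank, that is, there is $n<\omega$ such that for every set $A$, every family of $n$ infinite sequences of tuples which is mutually indiscernible over $A$, and every element $b$, one of the sequences is indiscernible over $A\cup\{b\}$ (everything taken in models of $T^*$). -/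

import Mathlib

open FirstOrder FirstOrder.Language CategoryTheory

universe u v w

namespace OpenConeTree

/-! ### Strong amalgamation -/

section Fraisse

variable {L : FirstOrder.Language.{u, v}}

/-- The class of finite models of a theory. As usual in Mathlib, the empty structure of a
relational language is allowed here. -/
def finiteModels (T : L.Theory) : Set (Bundled.{w} L.Structure) :=
  {N | Finite N ∧ (N : Type w) ⊨ T}

/-- Amalgamation in which the two images meet only in the image of the base. -/
def StrongAmalgamation (K : Set (Bundled.{w} L.Structure)) : Prop :=
  ∀ (M N P : Bundled.{w} L.Structure) (MN : M ↪[L] N) (MP : M ↪[L] P),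
    M ∈ K → N ∈ K → P ∈ K →
      ∃ (Q : Bundled.{w} L.Structure) (NQ : N ↪[L] Q) (PQ : P ↪[L] Q),
        Q ∈ K ∧ NQ.comp MN = PQ.comp MP ∧
          Set.range NQ ∩ Set.range PQ = Set.range (PQ.comp MP)

/-- Joint embedding with disjoint images. -/
def DisjointJointEmbedding (K : Set (Bundled.{w} L.Structure)) : Prop :=
  ∀ M N : Bundled.{w} L.Structure, M ∈ K → N ∈ K →
    ∃ (Q : Bundled.{w} L.Structure) (f : M ↪[L] Q) (g : N ↪[L] Q),
      Q ∈ K ∧ Disjoint (Set.range f) (Set.range g)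

/-- A Fraïssé class with the strong amalgamation property. -/
structure IsStrongFraisse (K : Set (Bundled.{w} L.Structure)) : Prop where
  isFraisse : IsFraisse K
  strongAmalgamation : StrongAmalgamation K
  disjointJointEmbedding : DisjointJointEmbedding K

end Fraisse

/-! ### Model completions -/

section ModelCompletion

variable {L : FirstOrder.Language.{u, v}}

/-- `T` is a model completion of `T₀`: it extends `T₀`, every model of `T₀` embeds into a model of
`T`, and for every model `M` of `T₀` the theory `T ∪ Diag(M)` is complete. The models of
`T ∪ Diag(M)` are the models of `T` together with an embedding of `M`, and the sentences in the
language with names for the elements of `M` are the formulas with variables indexed by `M`. -/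
structure IsModelCompletion (T₀ T : L.Theory) : Prop where
  extends_base : ∀ φ ∈ T₀, T ⊨ᵇ φ
  exists_embedding : ∀ M : Theory.ModelType.{u, v, max u v} T₀,
    ∃ N : Theory.ModelType.{u, v, max u v} T, Nonempty (M ↪[L] N)
  complete_diagram : ∀ (M : Theory.ModelType.{u, v, max u v} T₀)
    (N₁ N₂ : Theory.ModelType.{u, v, max u v} T) (f₁ : M ↪[L] N₁) (f₂ : M ↪[L] N₂)
    (φ : L.Formula M), φ.Realize f₁ ↔ φ.Realize f₂

end ModelCompletion

/-! ### NIP and dp-rank -/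

section Classification

variable {L : FirstOrder.Language.{u, v}}

/-- The formula `φ(x, y)` has the independence property in `T`: in some model of `T` there are
`(a_i)_{i < ω}` such that for every `s ⊆ ω` some `b` satisfies `φ(a_i, b)` exactly for `i ∈ s`. -/
def FormulaHasIP (T : L.Theory) {m n : ℕ} (φ : L.Formula (Fin m ⊕ Fin n)) : Prop :=
  ∃ (M : Theory.ModelType.{u, v, max u v} T) (a : ℕ → Fin m → M),
    ∀ s : Set ℕ, ∃ b : Fin n → M, ∀ i : ℕ, φ.Realize (Sum.elim (a i) b) ↔ i ∈ s

/-- A theory is NIP if no formula has the independence property in it. -/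
def IsNIP (T : L.Theory) : Prop :=
  ∀ (m n : ℕ) (φ : L.Formula (Fin m ⊕ Fin n)), ¬ FormulaHasIP T φ

variable (L) in
/-- The sequence `(a_j)_{j ∈ J}` of `κ`-tuples of `M` is indiscernible over `B`. -/
def IsIndiscernible {M : Type w} [L.Structure M] (B : Set M) {J κ : Type} [LinearOrder J]
    (a : J → κ → M) : Prop :=
  ∀ (n : ℕ) (φ : L.Formula (B ⊕ (Fin n × κ))) (s t : Fin n → J), StrictMono s → StrictMono t →
    (φ.Realize (Sum.elim (fun c : B => (c : M)) fun p => a (s p.1) p.2) ↔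
      φ.Realize (Sum.elim (fun c : B => (c : M)) fun p => a (t p.1) p.2))

variable (L) in
/-- The family of sequences `a x`, for `x ∈ X`, is mutually indiscernible over `A`: each of them is
indiscernible over `A` together with all the others. -/
def IsMutuallyIndiscernible {M : Type w} [L.Structure M] (A : Set M) {X : Type} {J κ : X → Type}
    [∀ x, LinearOrder (J x)] (a : ∀ x, J x → κ x → M) : Prop :=
  ∀ x, IsIndiscernible L (A ∪ {c | ∃ y, y ≠ x ∧ ∃ (j : J y) (k : κ y), a y j k = c}) (a x)

/-- The dp-rank of `T`, that is, of the partial type `x = x` in a single variable `x`, is less than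
the cardinality of `X`: for every set `A`, every family indexed by `X` of infinite sequences
mutually indiscernible over `A` and every element `b`, one of the sequences is indiscernible over
`A ∪ {b}`. -/
def DpRankLT (T : L.Theory) (X : Type) : Prop :=
  ∀ (M : Theory.ModelType.{u, v, max u v} T) (A : Set M) (J κ : X → Type)
    [∀ x, LinearOrder (J x)] [∀ x, Infinite (J x)] (a : ∀ x, J x → κ x → M),
    IsMutuallyIndiscernible L A a → ∀ b : M, ∃ x, IsIndiscernible L (insert b A) (a x)

/-- The dp-rank of `T` is less than some natural number. -/
def HasFiniteDpRank (T : L.Theory) : Prop :=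
  ∃ n : ℕ, DpRankLT T (Fin n)

end Classification

/-! ### Trees with structure on the open cones -/

/-- The function symbols of the language of meet-trees: a binary meet. -/
inductive TreeFunctions : ℕ → Type
  | meet : TreeFunctions 2

/-- The relation symbols: the order, and a symbol `R*` of arity `n + 1` for every symbol `R` of
arity `n`. -/
inductive TreeRelations (L : FirstOrder.Language.{u, v}) : ℕ → Type v
  | le : TreeRelations L 2
  | star {n : ℕ} (R : L.Relations n) : TreeRelations L (n + 1)

/-- The language `L* = {≤, ∧} ∪ {R* | R ∈ L}`. -/
def treeLanguage (L : FirstOrder.Language.{u, v}) : FirstOrder.Language.{0, v} :=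
  ⟨TreeFunctions, TreeRelations L⟩

section Tree

variable (L : FirstOrder.Language.{u, v})

/-- The symbol `∧`. -/
def meetSymb : (treeLanguage L).Functions 2 :=
  TreeFunctions.meet

variable {L} in
/-- The symbol `R*`. -/
def starSymb {n : ℕ} (R : L.Relations n) : (treeLanguage L).Relations (n + 1) :=
  TreeRelations.star R

instance : IsOrdered (treeLanguage L) :=
  ⟨TreeRelations.le⟩

instance : Countable (Σ l, (treeLanguage L).Functions l) :=
  Function.Injective.countable (f := fun p : Σ l, (treeLanguage L).Functions l => p.1) (by
    rintro ⟨_, ⟨⟩⟩ ⟨_, ⟨⟩⟩ _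
    rfl)

variable {L}

/-- The meet of two terms. -/
def meet {α : Type} (s t : (treeLanguage L).Term α) : (treeLanguage L).Term α :=
  (meetSymb L).apply₂ s t

/-- The atomic formula `R*(x, y₀, …, yₙ₋₁)`. -/
def star {m n : ℕ} (R : L.Relations n) (x : (treeLanguage L).Term (Empty ⊕ Fin m))
    (y : Fin n → (treeLanguage L).Term (Empty ⊕ Fin m)) :
    (treeLanguage L).BoundedFormula Empty m :=
  (starSymb R).boundedFormula
    (Fin.cons x y : Fin (n + 1) → (treeLanguage L).Term (Empty ⊕ Fin m))

variable (L)

/-- For every `x`, the set `{y | y ≤ x}` is linearly ordered. -/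
def linearBelow : (treeLanguage L).Sentence :=
  ∀' ∀' ∀' (((&1).le &0 ⊓ (&2).le &0) ⟹ ((&1).le &2 ⊔ (&2).le &1))

/-- `x ∧ y ≤ x, y`. -/
def meetLower : (treeLanguage L).Sentence :=
  ∀' ∀' ((meet &0 &1).le &0 ⊓ (meet &0 &1).le &1)

/-- If `z ≤ x, y` then `z ≤ x ∧ y`. -/
def meetGreatest : (treeLanguage L).Sentence :=
  ∀' ∀' ∀' (((&2).le &0 ⊓ (&2).le &1) ⟹ (&2).le (meet &0 &1))

/-- The theory of meet-trees. -/
def meetTreeTheory : (treeLanguage L).Theory :=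
  (treeLanguage L).partialOrderTheory ∪ {linearBelow L, meetLower L, meetGreatest L}

variable {L}

/-- Truth of `R*(x, y)` depends only on the open cones of center `x` of the entries of `y`.
The variables are `x = &0`, `yᵢ = &(i + 1)` and `yᵢ' = &(n + i + 1)`. -/
noncomputable def axiomWD {n : ℕ} (R : L.Relations n) : (treeLanguage L).Sentence :=
  let x : (treeLanguage L).Term (Empty ⊕ Fin (n + n + 1)) := &0
  let y : Fin n → (treeLanguage L).Term (Empty ⊕ Fin (n + n + 1)) :=
    fun i => &(Fin.castAdd n i).succ
  let y' : Fin n → (treeLanguage L).Term (Empty ⊕ Fin (n + n + 1)) :=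
    fun i => &(Fin.natAdd n i).succ
  ((star R x y ⊓ BoundedFormula.iInf fun i => x.lt (meet (y i) (y' i))) ⟹ star R x y').alls

/-- If `R*(x, y)` then `x < yᵢ` for all `i`. -/
noncomputable def axiomOC {n : ℕ} (R : L.Relations n) : (treeLanguage L).Sentence :=
  let x : (treeLanguage L).Term (Empty ⊕ Fin (n + 1)) := &0
  let y : Fin n → (treeLanguage L).Term (Empty ⊕ Fin (n + 1)) := fun i => &i.succ
  (star R x y ⟹ BoundedFormula.iInf fun i => x.lt (y i)).alls

/-- The variable `yᵢ` of a formula over a relational language `L`, as the variable `&(i + 1)`. -/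
def starTerm [L.IsRelational] {n : ℕ} :
    L.Term (Empty ⊕ Fin n) → (treeLanguage L).Term (Empty ⊕ Fin (n + 1))
  | .var (.inl e) => e.elim
  | .var (.inr i) => &i.succ
  | .func f _ => isEmptyElim f

/-- The formula `ψ*(x, y)`, with `x = &0` and `yᵢ = &(i + 1)`: every `R(…)` in `ψ(y)` is replaced
by `R*(x, …)`, and every `yᵢ = yⱼ` by `x < yᵢ ∧ yⱼ`, where `∧` is the meet. It is only applied to
quantifier-free `ψ`; in general, quantifiers range over the elements above `x`. -/
def starFormula [L.IsRelational] :
    {n : ℕ} → L.BoundedFormula Empty n → (treeLanguage L).BoundedFormula Empty (n + 1)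
  | _, .falsum => ⊥
  | _, .equal s t => (&0).lt (meet (starTerm s) (starTerm t))
  | _, .rel R ts => star R &0 fun i => starTerm (ts i)
  | _, .imp φ ψ => starFormula φ ⟹ starFormula ψ
  | n, .all φ => ∀' ((&0).lt (&(Fin.last (n + 1))) ⟹ starFormula φ)

/-- The sentence `∀ x y (x < y → ψ*(x, y))`. -/
noncomputable def axiomT [L.IsRelational] {n : ℕ} (ψ : L.BoundedFormula Empty n) :
    (treeLanguage L).Sentence :=
  ((BoundedFormula.iInf fun i : Fin n =>
      Term.lt (&0 : (treeLanguage L).Term (Empty ⊕ Fin (n + 1))) &i.succ) ⟹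
    starFormula ψ).alls

/-- The universal theory of meet-trees with a model of the universal theory `T₀` on the set of open
cones of every center. -/
def universalTreeTheory [L.IsRelational] (T₀ : L.Theory) : (treeLanguage L).Theory :=
  meetTreeTheory L ∪
    {φ | ∃ (n : ℕ) (R : L.Relations n), φ = axiomWD R ∨ φ = axiomOC R} ∪
    {φ | ∃ (n : ℕ) (ψ : L.BoundedFormula Empty n), ψ.IsQF ∧ ψ.alls ∈ T₀ ∧ φ = axiomT ψ}

end Tree

end OpenConeTree

/-!
The proof counts orbits. For a structure `M`, suppose that for some `C` and `k` the automorphisms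
fixing a finite set `E` have at most `C * (|E| + 1) ^ k` orbits on the elements of `M`. Then the
complete theory of `M` is NIP and its dp-rank is at most `k`:

* The number of orbits on `n`-tuples is polynomial too (`HasPolyOrbits.tuples`), whereas a formula
  that shatters `D` tuples needs `2 ^ D` orbits over a set of size linear in `D`
  (`HasPolyOrbits.isNIP`).
* If none of `k + 1` mutually indiscernible sequences is indiscernible over `b`, then by mutual
  indiscernibility a change of truth value can be prescribed at any two consecutive blocks of each
  sequence, for all sequences at once. As the theory is NIP, each element has a bounded number of
  changes along each sequence. Therefore `l` blocks in every sequence give about `l ^ (k + 1)` types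
  over a set of size linear in `l`, which contradicts the bound (`HasPolyOrbits.dpRankLT`).

Now let `M` be the Fraïssé limit of the trees, and let `T` be NIP. By ultrahomogeneity, it is enough
to count the possibilities for the atomic formulas that an element `b` satisfies over a finite tuple
`e` (`ConeTree.SameAtoms.exists_automorphism`). They are determined by the segment of the tree
spanned by `e` from which `b` branches off, which is given by two entries of `e`, by a bounded number
of truth values, and by the relations between `b` and `e` at a single center, the end of that segment
(`ConeTree.SameCode.sameAtoms`). The open cones of a center form a model of `T₀`, which embeds into
a model of `T`. Thus atomic formulas have bounded VC dimension there, and by the Sauer–Shelah lemma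
there are polynomially many possibilities for those relations (`ConeTree.atMostClasses_traces`).
Altogether, the number of orbits is polynomial (`exists_hasPolyOrbits`).

Conversely, let a formula have the independence property in `T`. Its truth value at a tuple depends
only on the atomic formulas that hold there (`IsModelCompletion.realize_iff`), so that it can be
replaced by a Boolean combination of atomic formulas. A finite part of the witnessing model is a
finite model of `T₀`. The tree with this model as the set of leaves above a root embeds into `M`,
and with the root as an additional parameter the translated formula shatters arbitrarily long
sequences in `M` (`isNIP_of_isNIP_completeTheory`).
-/

namespace OpenConeTree

/-! ### Polynomial bounds and counting classes -/

/-- `f` is bounded by a polynomial. -/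
def PolyBounded (f : ℕ → ℕ) : Prop :=
  ∃ C k : ℕ, ∀ n, f n ≤ C * (n + 1) ^ k

namespace PolyBounded

theorem of_le {f g : ℕ → ℕ} (hg : PolyBounded g) (h : ∀ n, f n ≤ g n) : PolyBounded f := by
  obtain ⟨C, k, hC⟩ := hg
  exact ⟨C, k, fun n => (h n).trans (hC n)⟩

theorem const (c : ℕ) : PolyBounded fun _ => c :=
  ⟨c, 0, fun n => by simp⟩

theorem id : PolyBounded fun n => n :=
  ⟨1, 1, fun n => by simp⟩

theorem mul {f g : ℕ → ℕ} (hf : PolyBounded f) (hg : PolyBounded g) :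
    PolyBounded fun n => f n * g n := by
  obtain ⟨C, k, hC⟩ := hf
  obtain ⟨D, l, hD⟩ := hg
  refine ⟨C * D, k + l, fun n => (Nat.mul_le_mul (hC n) (hD n)).trans (le_of_eq ?_)⟩
  rw [pow_add]
  ring

theorem add_one {f : ℕ → ℕ} (hf : PolyBounded f) : PolyBounded fun n => f n + 1 := by
  obtain ⟨C, k, hC⟩ := hf
  refine ⟨C + 1, k, fun n => ?_⟩
  have h1 : 1 ≤ (n + 1) ^ k := Nat.one_le_pow _ _ (Nat.succ_pos n)
  have := hC n
  change f n + 1 ≤ _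
  rw [add_mul]
  omega

theorem pow {f : ℕ → ℕ} (hf : PolyBounded f) (m : ℕ) : PolyBounded fun n => f n ^ m := by
  induction m with
  | zero => simpa using const 1
  | succ m ih => simpa only [pow_succ] using ih.mul hf

theorem prod {J : Type*} (s : Finset J) {f : J → ℕ → ℕ} (hf : ∀ j, PolyBounded (f j)) :
    PolyBounded fun n => ∏ j ∈ s, f j n := by
  classical
  induction s using Finset.induction_on with
  | empty => simpa using const 1
  | insert j s hj ih => simpa only [Finset.prod_insert hj] using (hf j).mul ih

theorem comp_affine {f : ℕ → ℕ} (hf : PolyBounded f) (a b : ℕ) :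
    PolyBounded fun n => f (a * n + b) := by
  obtain ⟨C, k, hC⟩ := hf
  refine ⟨C * (a + b + 1) ^ k, k, fun n => (hC _).trans ?_⟩
  rw [mul_assoc, ← mul_pow]
  refine Nat.mul_le_mul le_rfl (Nat.pow_le_pow_left ?_ k)
  nlinarith

theorem exists_lt_two_pow {f : ℕ → ℕ} (hf : PolyBounded f) : ∃ d, f d < 2 ^ d := by
  obtain ⟨C, k, hC⟩ := hf
  have h := (tendsto_pow_const_div_const_pow_of_one_lt k (r := (2 : ℝ)) (by norm_num)).comp
    (Filter.tendsto_add_atTop_nat 1)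
  have hpos : (0 : ℝ) < 1 / (2 * (C + 1)) := by positivity
  obtain ⟨d, hd⟩ := (h.eventually_lt_const hpos).exists
  refine ⟨d, (hC d).trans_lt ?_⟩
  simp only [Function.comp_apply] at hd
  rw [div_lt_div_iff₀ (by positivity) (by positivity), pow_succ] at hd
  have h2 : (C : ℝ) * ((d : ℝ) + 1) ^ k < 2 ^ d := by
    have h3 : (0 : ℝ) ≤ ((d : ℝ) + 1) ^ k := by positivity
    push_cast at hd
    nlinarith
  exact_mod_cast h2

end PolyBounded

/-- The relation `r` has at most `N` classes: there is a map to a set with `N` elements such that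
elements with the same value are related. -/
def AtMostClasses {α : Type*} (r : α → α → Prop) (N : ℕ) : Prop :=
  ∃ I : α → Fin N, ∀ x y, I x = I y → r x y

namespace AtMostClasses

variable {α : Type*} {r s : α → α → Prop} {N N' : ℕ}

theorem mono (h : AtMostClasses r N) (hrs : ∀ x y, r x y → s x y) (hN : N ≤ N') :
    AtMostClasses s N' := by
  obtain ⟨I, hI⟩ := h
  exact ⟨fun x => Fin.castLE hN (I x), fun x y hxy => hrs _ _ (hI _ _ (Fin.castLE_injective hN hxy))⟩

theorem comap {β : Type*} (h : AtMostClasses r N) (g : β → α) :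
    AtMostClasses (fun x y => r (g x) (g y)) N := by
  obtain ⟨I, hI⟩ := h
  exact ⟨I ∘ g, fun x y hxy => hI _ _ hxy⟩

theorem of_map {β : Type*} [Fintype β] (F : α → β) :
    AtMostClasses (fun x y => F x = F y) (Fintype.card β) :=
  ⟨fun x => Fintype.equivFin β (F x), fun _ _ h => (Fintype.equivFin β).injective h⟩

/-- The fibers of `F` are at most `N`, and each of them is divided into at most `N'` classes by a
relation of its own. -/
theorem bind {β : Type*} {F : α → β} {t : β → α → α → Prop}
    (h : AtMostClasses (fun x y => F x = F y) N) (ht : ∀ z, AtMostClasses (t z) N') :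
    AtMostClasses (fun x y => F x = F y ∧ t (F x) x y) (N * N') := by
  obtain ⟨I, hI⟩ := h
  choose K hK using ht
  refine ⟨fun x => finProdFinEquiv (I x, K (F x) x), fun x y hxy => ?_⟩
  have h1 := finProdFinEquiv.injective hxy
  obtain ⟨h2, h3⟩ := Prod.ext_iff.1 h1
  have h4 := hI _ _ h2
  refine ⟨h4, hK _ _ _ ?_⟩
  simp only at h3
  rw [h3, h4]

theorem and (h : AtMostClasses r N) (h' : AtMostClasses s N') :
    AtMostClasses (fun x y => r x y ∧ s x y) (N * N') := by
  obtain ⟨I, hI⟩ := h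
  obtain ⟨K, hK⟩ := h'
  refine ⟨fun x => finProdFinEquiv (I x, K x), fun x y hxy => ?_⟩
  obtain ⟨h2, h3⟩ := Prod.ext_iff.1 (finProdFinEquiv.injective hxy)
  exact ⟨hI _ _ h2, hK _ _ h3⟩

theorem forall_fintype {J : Type*} [Fintype J] {r : J → α → α → Prop} {N : J → ℕ}
    (h : ∀ j, AtMostClasses (r j) (N j)) :
    AtMostClasses (fun x y => ∀ j, r j x y) (∏ j, N j) := by
  classical
  choose I hI using h
  have := of_map (fun x : α => fun j => I j x)
  simp only [Fintype.card_pi, Fintype.card_fin] at this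
  exact this.mono (fun x y hxy j => hI j _ _ (congrFun hxy j)) le_rfl

theorem card_le (h : AtMostClasses r N) (B : Finset α)
    (hB : ∀ x ∈ B, ∀ y ∈ B, x ≠ y → ¬ r x y) : B.card ≤ N := by
  obtain ⟨I, hI⟩ := h
  have := Finset.card_le_card_of_injOn (s := B) (t := Finset.univ) I (fun _ _ => Finset.mem_univ _)
    (fun x hx y hy hxy => by
      by_contra hne
      exact hB x hx y hy hne (hI _ _ hxy))
  simpa using this

end AtMostClasses

theorem sum_Iic_choose_le (N d : ℕ) : ∑ k ∈ Finset.Iic d, N.choose k ≤ (N + 1) ^ d := by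
  induction d with
  | zero => simp [show Finset.Iic 0 = {0} from rfl]
  | succ d ih =>
    have h : Finset.Iic (d + 1) = insert (d + 1) (Finset.Iic d) := by
      ext x
      simp only [Finset.mem_Iic, Finset.mem_insert]
      omega
    rw [h, Finset.sum_insert (by simp), pow_succ]
    have h1 : N.choose (d + 1) ≤ N ^ (d + 1) := Nat.choose_le_pow _ _
    have h2 : N ^ d ≤ (N + 1) ^ d := Nat.pow_le_pow_left (Nat.le_succ N) d
    rw [pow_succ] at h1
    nlinarith

/-- The Sauer–Shelah lemma for the traces `f b`, where `b` ranges over an arbitrary type: if only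
sets with at most `d` elements are shattered, then there are polynomially many traces. -/
theorem AtMostClasses.of_not_shatters {α β : Type*} [Fintype α] (f : β → Set α) (d : ℕ)
    (h : ∀ S : Finset α, (∀ t ⊆ S, ∃ b, ∀ x ∈ S, x ∈ f b ↔ x ∈ t) → S.card ≤ d) :
    AtMostClasses (fun b b' => f b = f b') ((Fintype.card α + 1) ^ d) := by
  classical
  let 𝒜 : Finset (Finset α) := Finset.univ.filter fun t => ∃ b, f b = (t : Set α)
  have hmem : ∀ b, (Finset.univ.filter fun x => x ∈ f b) ∈ 𝒜 := fun b => by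
    simp only [𝒜, Finset.mem_filter, Finset.mem_univ, true_and]
    exact ⟨b, by simp⟩
  have hvc : 𝒜.vcDim ≤ d := by
    refine Finset.sup_le fun S hS => h S fun t ht => ?_
    obtain ⟨c, hc, hct⟩ := Finset.mem_shatterer.1 hS ht
    obtain ⟨b, hb⟩ := (Finset.mem_filter.1 hc).2
    refine ⟨b, fun x hx => ?_⟩
    rw [hb, ← hct]
    simp [hx]
  have hcard : 𝒜.card ≤ (Fintype.card α + 1) ^ d :=
    calc 𝒜.card ≤ 𝒜.shatterer.card := Finset.card_le_card_shatterer 𝒜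
      _ ≤ ∑ k ∈ Finset.Iic 𝒜.vcDim, (Fintype.card α).choose k := Finset.card_shatterer_le_sum_vcDim
      _ ≤ (Fintype.card α + 1) ^ 𝒜.vcDim := sum_Iic_choose_le _ _
      _ ≤ _ := Nat.pow_le_pow_right (Nat.succ_pos _) hvc
  have := AtMostClasses.of_map (fun b => (⟨_, hmem b⟩ : 𝒜))
  refine this.mono (fun b b' hbb => ?_) (by simpa using hcard)
  have h1 := congrArg (fun z : 𝒜 => (z : Finset α)) hbb
  ext x
  simpa using congrArg (fun z => x ∈ z) h1

/-! ### Finite configurations of formulas -/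

section Configurations

variable {L : FirstOrder.Language.{u, v}}

/-- A formula uses only finitely many of its variables. -/
theorem exists_finite_variables {V : Type*} (φ : L.Formula V) :
    ∃ (F : Finset V) (ψ : L.Formula F), ∀ (M : Type w) [L.Structure M] (d : V → M),
      ψ.Realize (fun i : F => d i) ↔ φ.Realize d := by
  classical
  exact ⟨φ.freeVarFinset, φ.restrictFreeVar id, fun M _ d =>
    BoundedFormula.realize_restrictFreeVar d fun _ => rfl⟩

/-- Finite families of truth values are realized in every model of the complete theory. -/
theorem exists_tuple_of_completeTheory {M : Type*} [L.Structure M] {N : Type*} [L.Structure N]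
    [Nonempty N] (h : N ⊨ L.completeTheory M) {V J : Type*} [Finite V] [Finite J]
    (φ : J → L.Formula V) (d : V → N) :
    ∃ d' : V → M, ∀ j, (φ j).Realize d' ↔ (φ j).Realize d := by
  classical
  let ψ : J → L.Formula V := fun j => if (φ j).Realize d then φ j else (φ j).not
  let χ : L.Formula V := Formula.iInf ψ
  have hχ : χ.Realize d := by
    rw [Formula.realize_iInf]
    intro j
    by_cases hj : (φ j).Realize d
    · simp [ψ, hj]
    · simp [ψ, hj]
  let σ : L.Sentence := Formula.iExs V (χ.relabel (Sum.inr : V → Empty ⊕ V))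
  have hM' : M ⊨ σ ↔ ∃ d' : V → M, χ.Realize d' := by
    simp only [σ, Sentence.Realize, Formula.realize_iExs, Formula.realize_relabel]
    exact Iff.rfl
  have hN' : N ⊨ σ ↔ ∃ d' : V → N, χ.Realize d' := by
    simp only [σ, Sentence.Realize, Formula.realize_iExs, Formula.realize_relabel]
    exact Iff.rfl
  have hM : M ⊨ σ := by
    by_contra hM
    have h1 : σ.not ∈ L.completeTheory M := by
      rw [mem_completeTheory, Sentence.realize_not]
      exact hM
    have h2 := h.realize_of_mem _ h1
    rw [Sentence.realize_not] at h2
    exact h2 (hN'.2 ⟨d, hχ⟩)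
  obtain ⟨d', hd'⟩ := hM'.1 hM
  refine ⟨d', fun j => ?_⟩
  rw [Formula.realize_iInf] at hd'
  have := hd' j
  by_cases hj : (φ j).Realize d
  · simpa [ψ, hj] using this
  · simpa [ψ, hj] using this

/-- Every Boolean combination of finitely many formulas is a formula. -/
theorem exists_formula_of_truth_values {V J : Type*} [Finite J] (θ : J → L.Formula V)
    (S : Set (J → Prop)) :
    ∃ φ : L.Formula V, ∀ (M : Type w) [L.Structure M] (d : V → M),
      φ.Realize d ↔ (fun j => (θ j).Realize d) ∈ S := by
  classical
  let χ : (J → Prop) → L.Formula V := fun σ =>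
    Formula.iInf fun j => if σ j then θ j else (θ j).not
  refine ⟨Formula.iSup fun σ : S => χ σ, fun M _ d => ?_⟩
  rw [Formula.realize_iSup]
  have hχ : ∀ σ, (χ σ).Realize d ↔ σ = fun j => (θ j).Realize d := by
    intro σ
    simp only [χ, Formula.realize_iInf, funext_iff]
    refine forall_congr' fun j => ?_
    by_cases hj : σ j
    · simp [hj]
    · simp [hj]
  constructor
  · rintro ⟨σ, hσ⟩
    rw [hχ] at hσ
    exact hσ ▸ σ.2
  · intro h
    exact ⟨⟨_, h⟩, (hχ _).2 rfl⟩

end Configurations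

/-! ### Shattering -/

section Shattering

variable {L : FirstOrder.Language.{u, v}}

/-- `φ(x, y)` shatters a sequence of `D` tuples of `M`. -/
def FormulaShatters {m n : ℕ} (φ : L.Formula (Fin m ⊕ Fin n)) (M : Type*) [L.Structure M]
    (D : ℕ) : Prop :=
  ∃ a : Fin D → Fin m → M, ∀ s : Set (Fin D), ∃ b : Fin n → M,
    ∀ i, φ.Realize (Sum.elim (a i) b) ↔ i ∈ s

theorem FormulaShatters.map {m n : ℕ} {φ : L.Formula (Fin m ⊕ Fin n)}
    {M N : Type*} [L.Structure M] [L.Structure N] {D : ℕ} (f : M → N)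
    (hf : ∀ d : Fin m ⊕ Fin n → M, φ.Realize (f ∘ d) ↔ φ.Realize d)
    (h : FormulaShatters φ M D) : FormulaShatters φ N D := by
  obtain ⟨a, ha⟩ := h
  refine ⟨fun i => f ∘ a i, fun s => ?_⟩
  obtain ⟨b, hb⟩ := ha s
  refine ⟨f ∘ b, fun i => ?_⟩
  rw [← hb i, ← hf, Sum.comp_elim]

/-- Compactness, by an ultraproduct: a formula that shatters arbitrarily long finite sequences has
the independence property. -/
theorem formulaHasIP_of_forall_formulaShatters {T : L.Theory} {m n : ℕ}
    (φ : L.Formula (Fin m ⊕ Fin n))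
    (h : ∀ D, ∃ M : Theory.ModelType.{u, v, max u v} T, FormulaShatters φ M D) :
    FormulaHasIP T φ := by
  choose M a ha using h
  choose b hb using ha
  let U : Ultrafilter ℕ := Filter.hyperfilter ℕ
  have : ∀ D, Nonempty (M D) := fun D => (M D).nonempty'
  let P := (U : Filter ℕ).Product fun D => M D
  have hP : P ⊨ T := ⟨fun σ hσ => Ultraproduct.sentence_realize σ |>.2
    (Filter.Eventually.of_forall fun D => (M D).is_model.realize_of_mem σ hσ)⟩
  let a' : ℕ → Fin m → ∀ D, M D := fun i k D =>
    if hi : i < D then a D ⟨i, hi⟩ k else Classical.arbitrary _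
  let b' : Set ℕ → Fin n → ∀ D, M D := fun s k D => b D {i | (i : ℕ) ∈ s} k
  refine ⟨Theory.ModelType.of T P, fun i k => (a' i k : P), fun s => ⟨fun k => (b' s k : P),
    fun i => ?_⟩⟩
  have h1 : (Sum.elim (fun k => (a' i k : P)) fun k => (b' s k : P)) =
      fun x : Fin m ⊕ Fin n => ((Sum.elim (a' i) (b' s) x : ∀ D, M D) : P) := by
    funext x
    cases x <;> rfl
  have h2 : (φ.Realize fun x : Fin m ⊕ Fin n => ((Sum.elim (a' i) (b' s) x : ∀ D, M D) : P)) ↔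
      ∀ᶠ D in (U : Filter ℕ), φ.Realize fun x => Sum.elim (a' i) (b' s) x D :=
    Ultraproduct.realize_formula_cast φ _
  refine (iff_of_eq (congrArg φ.Realize h1)).trans (h2.trans ?_)
  have hU : ∀ᶠ D in (U : Filter ℕ), i < D :=
    Filter.Eventually.filter_mono Nat.hyperfilter_le_atTop (Filter.eventually_gt_atTop i)
  have h3 : ∀ᶠ D in (U : Filter ℕ),
      ((φ.Realize fun x => Sum.elim (a' i) (b' s) x D) ↔ i ∈ s) := by
    filter_upwards [hU] with D hD
    have h4 : (fun x : Fin m ⊕ Fin n => Sum.elim (a' i) (b' s) x D) =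
        Sum.elim (a D ⟨i, hD⟩) (b D {i | (i : ℕ) ∈ s}) := by
      funext x
      cases x with
      | inl k => simp [a', hD]
      | inr k => rfl
    rw [h4, hb]
    rfl
  rw [Filter.eventually_congr h3, Filter.eventually_const]

theorem FormulaHasIP.exists_formulaShatters {T : L.Theory} {m n : ℕ}
    {φ : L.Formula (Fin m ⊕ Fin n)} (h : FormulaHasIP T φ) (D : ℕ) :
    ∃ M : Theory.ModelType.{u, v, max u v} T, FormulaShatters φ M D := by
  obtain ⟨M, a, h⟩ := h
  refine ⟨M, fun i => a i, fun s => ?_⟩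
  obtain ⟨b, hb⟩ := h ((fun i : Fin D => (i : ℕ)) '' s)
  exact ⟨b, fun i => (hb i).trans (Fin.val_injective.mem_set_image)⟩

end Shattering

/-! ### Orbits over finite sets and NIP -/

section Orbits

variable (L : FirstOrder.Language.{u, v})

/-- The tuples `b` and `b'` are conjugate under the automorphisms of `M` that fix `E` pointwise. -/
def ConjugateOver {M : Type*} [L.Structure M] {V : Type*} (E : Finset M) (b b' : V → M) : Prop :=
  ∃ σ : M ≃[L] M, (∀ x ∈ E, σ x = x) ∧ ∀ i, σ (b i) = b' i

/-- For every finite set `E`, the number of orbits of single elements under the automorphisms fixing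
`E` pointwise is at most `C * (|E| + 1) ^ k`, where `C` does not depend on `E`. -/
def HasPolyOrbits (M : Type*) [L.Structure M] (k : ℕ) : Prop :=
  ∃ C : ℕ, ∀ E : Finset M,
    AtMostClasses (fun b b' : M => ConjugateOver L E (fun _ : Unit => b) fun _ => b')
      (C * (E.card + 1) ^ k)

variable {L}

theorem ConjugateOver.realize_iff {M : Type*} [L.Structure M] {V : Type*} {E : Finset M}
    {b b' : V → M} (h : ConjugateOver L E b b') {W : Type*} (φ : L.Formula (W ⊕ V)) (c : W → M)
    (hc : ∀ i, c i ∈ E) : φ.Realize (Sum.elim c b) ↔ φ.Realize (Sum.elim c b') := by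
  obtain ⟨σ, hE, hb⟩ := h
  have : Sum.elim c b' = σ ∘ Sum.elim c b := by
    funext x
    cases x with
    | inl i => exact (hE _ (hc i)).symm
    | inr i => exact (hb i).symm
  rw [this, StrongHomClass.realize_formula]

/-- The number of orbits of `n`-tuples is polynomial as well: normalize the first entry of a tuple
to a representative of its orbit and count the remaining entries over that representative. -/
theorem HasPolyOrbits.tuples {M : Type*} [L.Structure M] {k : ℕ} (h : HasPolyOrbits L M k)
    (n : ℕ) : ∃ C l : ℕ, ∀ E : Finset M,
      AtMostClasses (ConjugateOver (V := Fin n) L E) (C * (E.card + 1) ^ l) := by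
  classical
  obtain ⟨C₀, h⟩ := h
  rcases isEmpty_or_nonempty M with hM | hM
  · refine ⟨1, 0, fun E => ⟨fun _ => ⟨0, by simp⟩, fun x y _ => ?_⟩⟩
    exact ⟨Language.Equiv.refl L M, fun x => hM.elim x, fun i => hM.elim (x i)⟩
  induction n with
  | zero =>
    exact ⟨1, 0, fun E => ⟨fun _ => ⟨0, by simp⟩, fun x y _ =>
      ⟨Language.Equiv.refl L M, fun x _ => rfl, fun i => i.elim0⟩⟩⟩
  | succ n ih =>
    obtain ⟨C₁, l, ih⟩ := ih
    obtain ⟨C, l', hC⟩ : PolyBounded fun m => (C₀ * (m + 1) ^ k) * (C₁ * (m + 1 + 1) ^ l) :=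
      PolyBounded.mul ⟨C₀, k, fun _ => le_rfl⟩
        ((show PolyBounded fun m => C₁ * (m + 1) ^ l from ⟨C₁, l, fun _ => le_rfl⟩).comp_affine 1 1
          |>.of_le fun n => by simp)
    refine ⟨C, l', fun E => ?_⟩
    obtain ⟨I, hI⟩ := h E
    -- `rep x` represents the orbit of `x`, and `σ x` moves `x` there.
    let rep : M → M := fun x => Function.invFun I (I x)
    have hrep : ∀ x, I x = I (rep x) := fun x => (Function.invFun_eq ⟨x, rfl⟩).symm
    choose σ hσE hσ using fun x => hI _ _ (hrep x)
    have hF : AtMostClasses (fun b b' : Fin (n + 1) → M => rep (b 0) = rep (b' 0))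
        (C₀ * (E.card + 1) ^ k) :=
      ⟨fun b => I (b 0), fun b b' hb => congrArg (Function.invFun I) hb⟩
    have ht : ∀ z, AtMostClasses (fun b b' : Fin (n + 1) → M =>
        ConjugateOver L (insert z E) (fun i => σ (b 0) (Fin.tail b i))
          (fun i => σ (b' 0) (Fin.tail b' i))) (C₁ * (E.card + 1 + 1) ^ l) := fun z =>
      ((ih (insert z E)).comap fun (b : Fin (n + 1) → M) i => σ (b 0) (Fin.tail b i)).mono
        (fun _ _ h => h) (Nat.mul_le_mul le_rfl (Nat.pow_le_pow_left
          (Nat.succ_le_succ (Finset.card_insert_le _ _)) _))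
    refine (hF.bind ht).mono ?_ (hC _)
    rintro b b' ⟨h1, τ, hτE, hτ⟩
    refine ⟨(σ (b' 0)).symm.comp (τ.comp (σ (b 0))), fun x hx => ?_, fun i => ?_⟩
    · simp only [Language.Equiv.comp_apply]
      rw [hσE _ x hx, hτE x (Finset.mem_insert_of_mem hx)]
      exact (σ (b' 0)).injective (by rw [Language.Equiv.apply_symm_apply, hσE _ x hx])
    · simp only [Language.Equiv.comp_apply]
      apply (σ (b' 0)).injective
      rw [Language.Equiv.apply_symm_apply]
      refine Fin.cases ?_ (fun i => ?_) i
      · have h2 := hσ (b 0) ()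
        have h3 := hσ (b' 0) ()
        simp only at h2 h3
        rw [h2, h3, hτE _ (Finset.mem_insert_self _ _), h1]
      · exact hτ i

/-- If the number of orbits over finite sets is polynomial, too few tuples are available to shatter
long sequences. -/
theorem HasPolyOrbits.isNIP {M : Type*} [L.Structure M] {k : ℕ} (h : HasPolyOrbits L M k) :
    IsNIP (L.completeTheory M) := by
  classical
  intro m n φ hIP
  obtain ⟨C, l, hC⟩ := h.tuples n
  obtain ⟨D, hD⟩ := ((show PolyBounded fun m => C * (m + 1) ^ l from
    ⟨C, l, fun _ => le_rfl⟩).comp_affine m 0).exists_lt_two_pow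
  obtain ⟨N, a, ha⟩ := hIP.exists_formulaShatters D
  choose b hb using ha
  obtain ⟨d, hd⟩ := exists_tuple_of_completeTheory (M := M) (N := N) N.is_model
    (V := (Fin D × Fin m) ⊕ (Set (Fin D) × Fin n)) (J := Fin D × Set (Fin D))
    (fun j => φ.relabel (Sum.map (fun k => (j.1, k)) fun k => (j.2, k)))
    (Sum.elim (fun p => a p.1 p.2) fun p => b p.1 p.2)
  let E : Finset M := Finset.univ.image fun p => d (Sum.inl p)
  have hE : E.card ≤ m * D + 0 := by
    refine Finset.card_image_le.trans ?_
    simp [mul_comm]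
  have h1 := ((hC E).comap fun (s : Set (Fin D)) k => d (Sum.inr (s, k))).card_le Finset.univ
    (fun s _ t _ hst hconj => hst ?_)
  · have h2 : C * (E.card + 1) ^ l ≤ C * (m * D + 0 + 1) ^ l :=
      Nat.mul_le_mul le_rfl (Nat.pow_le_pow_left (Nat.succ_le_succ hE) _)
    have h3 := (h1.trans h2).trans_lt hD
    simp at h3
  · ext i
    have key : ∀ s : Set (Fin D), φ.Realize (Sum.elim (fun k => d (Sum.inl (i, k)))
        fun k => d (Sum.inr (s, k))) ↔ i ∈ s := by
      intro s
      have := hd (i, s)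
      rw [Formula.realize_relabel, Formula.realize_relabel] at this
      have e1 : d ∘ Sum.map (fun k => (i, k)) (fun k => (s, k)) =
          Sum.elim (fun k => d (Sum.inl (i, k))) fun k => d (Sum.inr (s, k)) := by
        funext x
        cases x <;> rfl
      have e2 : (Sum.elim (fun p => a p.1 p.2) fun p => b p.1 p.2) ∘
          Sum.map (fun k => (i, k)) (fun k => (s, k)) = Sum.elim (a i) (b s) := by
        funext x
        cases x <;> rfl
      rw [e1, e2] at this
      exact this.trans (hb s i)
    rw [← key s, ← key t]
    exact hconj.realize_iff φ _ fun k => Finset.mem_image_of_mem _ (Finset.mem_univ _)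

/-- Elements of a model of the theory of `M` that are pairwise distinguished by formulas over a
finite set are at most as many as orbits over a set of that size in `M`. -/
theorem card_le_of_distinguished {M : Type*} [L.Structure M] {C k : ℕ}
    (h : ∀ E : Finset M,
      AtMostClasses (fun b b' : M => ConjugateOver L E (fun _ : Unit => b) fun _ => b')
        (C * (E.card + 1) ^ k))
    {N : Type*} [L.Structure N] [Nonempty N] (hN : N ⊨ L.completeTheory M) (E : Finset N)
    {β : Type*} [Fintype β] (b : β → N)
    (hb : ∀ x y, x ≠ y → ∃ χ : L.Formula (E ⊕ Unit),
      ¬ (χ.Realize (Sum.elim (fun z : E => (z : N)) fun _ => b x) ↔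
        χ.Realize (Sum.elim (fun z : E => (z : N)) fun _ => b y))) :
    Fintype.card β ≤ C * (E.card + 1) ^ k := by
  classical
  have hb' : ∀ x y, ∃ χ : L.Formula (E ⊕ Unit), x ≠ y →
      ¬ (χ.Realize (Sum.elim (fun z : E => (z : N)) fun _ => b x) ↔
        χ.Realize (Sum.elim (fun z : E => (z : N)) fun _ => b y)) := by
    intro x y
    by_cases hxy : x = y
    · exact ⟨⊥, fun h => (h hxy).elim⟩
    · obtain ⟨χ, hχ⟩ := hb x y hxy
      exact ⟨χ, fun _ => hχ⟩
  choose χ hχ using hb'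
  obtain ⟨d, hd⟩ := exists_tuple_of_completeTheory (M := M) (N := N) hN
    (V := E ⊕ β) (J := (β × β) × β)
    (fun j => (χ j.1.1 j.1.2).relabel (Sum.map id fun _ => j.2))
    (Sum.elim (fun z : E => (z : N)) b)
  let E' : Finset M := Finset.univ.image fun p : E => d (Sum.inl p)
  have hE : E'.card ≤ E.card := Finset.card_image_le.trans (by simp)
  have h1 := ((h E').comap fun x : β => d (Sum.inr x)).card_le Finset.univ
    (fun x _ y _ hxy hconj => hχ x y hxy ?_)
  · exact h1.trans (Nat.mul_le_mul le_rfl (Nat.pow_le_pow_left (Nat.succ_le_succ hE) _))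
  · have key : ∀ z, (χ x y).Realize (Sum.elim (fun p : E => d (Sum.inl p))
        fun _ => d (Sum.inr z)) ↔
        (χ x y).Realize (Sum.elim (fun p : E => (p : N)) fun _ => b z) := by
      intro z
      have := hd ((x, y), z)
      rw [Formula.realize_relabel, Formula.realize_relabel] at this
      have e1 : d ∘ Sum.map id (fun _ : Unit => z) =
          Sum.elim (fun p : E => d (Sum.inl p)) fun _ => d (Sum.inr z) := by
        funext x
        cases x <;> rfl
      have e2 : (Sum.elim (fun z : E => (z : N)) b) ∘
          Sum.map id (fun _ : Unit => z) = Sum.elim (fun p : E => (p : N)) fun _ => b z := by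
        funext x
        cases x <;> rfl
      rw [e1, e2] at this
      exact this
    rw [← key x, ← key y]
    exact hconj.realize_iff _ _ fun p => Finset.mem_image_of_mem _ (Finset.mem_univ _)

end Orbits

/-! ### Mutually indiscernible sequences -/

section MutuallyIndiscernible

variable {L : FirstOrder.Language.{u, v}} {M : Type w} [L.Structure M]

/-- One of the increasing subsequences can be exchanged, because the entries of the others count as
parameters. -/
theorem IsMutuallyIndiscernible.realize_update {A : Set M} {X : Type} [DecidableEq X]
    {J κ : X → Type} [∀ x, LinearOrder (J x)] {a : ∀ x, J x → κ x → M}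
    (h : IsMutuallyIndiscernible L A a) {l : X → ℕ} (ψ : L.Formula (A ⊕ Σ x, Fin (l x) × κ x))
    (w : ∀ x, Fin (l x) → J x) (x : X) (v : Fin (l x) → J x) (hw : StrictMono (w x))
    (hv : StrictMono v) :
    ψ.Realize (Sum.elim (fun c : A => (c : M)) fun p => a p.1 (w p.1 p.2.1) p.2.2) ↔
      ψ.Realize (Sum.elim (fun c : A => (c : M)) fun p =>
        a p.1 (Function.update w x v p.1 p.2.1) p.2.2) := by
  let A' : Set M := A ∪ {c | ∃ y, y ≠ x ∧ ∃ (j : J y) (k : κ y), a y j k = c}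
  let ρ : (A ⊕ Σ x, Fin (l x) × κ x) → A' ⊕ (Fin (l x) × κ x) := Sum.elim
    (fun c => Sum.inl ⟨c, Or.inl c.2⟩)
    fun p => if hp : p.1 = x then Sum.inr (hp ▸ p.2)
      else Sum.inl ⟨a p.1 (w p.1 p.2.1) p.2.2, Or.inr ⟨p.1, hp, _, _, rfl⟩⟩
  have := h x (l x) (ψ.relabel ρ) (w x) v hw hv
  rw [Formula.realize_relabel, Formula.realize_relabel] at this
  convert this using 2
  · funext p
    rcases p with c | ⟨y, i, k⟩
    · rfl
    · by_cases hy : y = x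
      · subst hy
        simp [ρ]
      · simp [ρ, hy]
  · funext p
    rcases p with c | ⟨y, i, k⟩
    · rfl
    · by_cases hy : y = x
      · subst hy
        simp [ρ]
      · simp [ρ, hy]

theorem IsMutuallyIndiscernible.realize_iff {A : Set M} {X : Type} [Finite X]
    {J κ : X → Type} [∀ x, LinearOrder (J x)] {a : ∀ x, J x → κ x → M}
    (h : IsMutuallyIndiscernible L A a) {l : X → ℕ} (ψ : L.Formula (A ⊕ Σ x, Fin (l x) × κ x))
    (w w' : ∀ x, Fin (l x) → J x) (hw : ∀ x, StrictMono (w x)) (hw' : ∀ x, StrictMono (w' x)) :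
    ψ.Realize (Sum.elim (fun c : A => (c : M)) fun p => a p.1 (w p.1 p.2.1) p.2.2) ↔
      ψ.Realize (Sum.elim (fun c : A => (c : M)) fun p => a p.1 (w' p.1 p.2.1) p.2.2) := by
  classical
  have := Fintype.ofFinite X
  have key : ∀ S : Finset X,
      (ψ.Realize (Sum.elim (fun c : A => (c : M)) fun p => a p.1 (w p.1 p.2.1) p.2.2) ↔
      ψ.Realize (Sum.elim (fun c : A => (c : M)) fun p =>
        a p.1 (S.piecewise w' w p.1 p.2.1) p.2.2)) := by
    intro S
    induction S using Finset.induction_on with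
    | empty => simp
    | insert x S hx ih =>
      rw [ih, Finset.piecewise_insert]
      refine h.realize_update ψ _ x (w' x) ?_ (hw' x)
      rw [Finset.piecewise_eq_of_notMem _ _ _ hx]
      exact hw x
  simpa using key Finset.univ

open Classical in
/-- The truth value of `φ` when `b'` is put in place of the parameter `b`. -/
def RealizeAt {A : Set M} {b : M} {I : Type*} (φ : L.Formula (↥(insert b A) ⊕ I)) (b' : M)
    (c : I → M) : Prop :=
  φ.Realize (Sum.elim (fun z : ↥(insert b A) => if (z : M) = b then b' else z) c)

theorem realizeAt_self {A : Set M} {b : M} {I : Type*} (φ : L.Formula (↥(insert b A) ⊕ I))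
    (c : I → M) : RealizeAt φ b c ↔ φ.Realize (Sum.elim (fun z : ↥(insert b A) => (z : M)) c) := by
  classical
  unfold RealizeAt
  have : (fun z : ↥(insert b A) => if (z : M) = b then b else (z : M)) =
      fun z : ↥(insert b A) => (z : M) := by
    funext z
    split_ifs with h
    · exact h.symm
    · rfl
  rw [← this]

/-- A pattern of truth values that some element realizes on finite increasing subsequences of
mutually indiscernible sequences is realized on all other increasing subsequences. -/
theorem IsMutuallyIndiscernible.exists_realizeAt {A : Set M} {X : Type} [Finite X]
    {J κ : X → Type} [∀ x, LinearOrder (J x)] {a : ∀ x, J x → κ x → M}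
    (h : IsMutuallyIndiscernible L A a) {b : M} {r : X → ℕ}
    (φ : ∀ x, L.Formula (↥(insert b A) ⊕ Fin (r x) × κ x)) {Q : Type} [Finite Q] {l : X → ℕ}
    (ξ : Q → X) (u : ∀ q, Fin (r (ξ q)) → Fin (l (ξ q))) (S : Set (Q → Prop))
    (w w' : ∀ x, Fin (l x) → J x) (hw : ∀ x, StrictMono (w x)) (hw' : ∀ x, StrictMono (w' x))
    (hS : ∃ b', (fun q => RealizeAt (φ (ξ q)) b' fun p => a (ξ q) (w (ξ q) (u q p.1)) p.2) ∈ S) :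
    ∃ b', (fun q => RealizeAt (φ (ξ q)) b' fun p => a (ξ q) (w' (ξ q) (u q p.1)) p.2) ∈ S := by
  classical
  let θ : Q → L.Formula ((A ⊕ Σ x, Fin (l x) × κ x) ⊕ Unit) := fun q =>
    (φ (ξ q)).relabel (Sum.elim
      (fun z : ↥(insert b A) => if hz : (z : M) = b then Sum.inr ()
        else Sum.inl (Sum.inl ⟨z, z.2.resolve_left hz⟩))
      fun p : Fin (r (ξ q)) × κ (ξ q) => Sum.inl (Sum.inr ⟨ξ q, u q p.1, p.2⟩))
  obtain ⟨χ, hχ⟩ := exists_formula_of_truth_values.{u, v, w} θ S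
  have hθ : ∀ (w : ∀ x, Fin (l x) → J x),
      ((χ.iExs Unit).Realize
        (Sum.elim (fun c : A => (c : M)) fun p => a p.1 (w p.1 p.2.1) p.2.2)) ↔
      ∃ b', (fun q => RealizeAt (φ (ξ q)) b' fun p => a (ξ q) (w (ξ q) (u q p.1)) p.2) ∈ S := by
    intro w
    rw [Formula.realize_iExs]
    have key : ∀ b' : Unit → M, (fun q => (θ q).Realize (Sum.elim (Sum.elim (fun c : A => (c : M))
          fun p => a p.1 (w p.1 p.2.1) p.2.2) b')) =
        fun q => RealizeAt (φ (ξ q)) (b' ()) fun p => a (ξ q) (w (ξ q) (u q p.1)) p.2 := by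
      intro b'
      funext q
      simp only [θ, Formula.realize_relabel, RealizeAt]
      congr 1
      funext z
      rcases z with z | z
      · by_cases hz : (z : M) = b
        · simp [hz]
        · simp [hz]
      · rfl
    constructor
    · rintro ⟨b', hb'⟩
      rw [hχ, key] at hb'
      exact ⟨_, hb'⟩
    · rintro ⟨b', hb'⟩
      refine ⟨fun _ => b', ?_⟩
      rw [hχ, key]
      exact hb'
  rw [← hθ] at hS ⊢
  exact (h.realize_iff _ w w' hw hw').1 hS

/-- Only finitely many parameters matter for `RealizeAt`. -/
theorem exists_formula_realizeAt {A : Set M} {b : M} {I : Type*}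
    (φ : L.Formula (↥(insert b A) ⊕ I)) :
    ∃ F : Finset (↥(insert b A) ⊕ I), ∀ (c : I → M) (E : Finset M),
      (∀ v ∈ F, Sum.elim (fun z : ↥(insert b A) => (z : M)) c v ∈ E) →
        ∃ χ : L.Formula (E ⊕ Unit), ∀ b',
          χ.Realize (Sum.elim (fun z : E => (z : M)) fun _ => b') ↔ RealizeAt φ b' c := by
  classical
  obtain ⟨F, ψ, hψ⟩ := exists_finite_variables.{u, v, w} φ
  refine ⟨F, fun c E hE => ?_⟩
  let ρ : F → E ⊕ Unit := fun v =>
    if ∃ z : ↥(insert b A), (v : ↥(insert b A) ⊕ I) = Sum.inl z ∧ (z : M) = b then Sum.inr ()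
    else Sum.inl ⟨_, hE v v.2⟩
  refine ⟨ψ.relabel ρ, fun b' => ?_⟩
  rw [RealizeAt, ← hψ M, Formula.realize_relabel]
  have : (Sum.elim (fun z : E => (z : M)) fun _ => b') ∘ ρ =
      fun i : F => Sum.elim (fun z : ↥(insert b A) => if (z : M) = b then b' else z) c i := by
    funext v
    obtain ⟨v, hv⟩ := v
    rcases v with ⟨z, hzA⟩ | i
    · by_cases hz : z = b
      · subst hz
        simp [ρ]
      · simp [ρ, hz]
    · simp [ρ]
  rw [this]

end MutuallyIndiscernible

/-! ### Blocks of a sequence and the dp-rank -/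

section Blocks

/-- Consecutive increasing tuples of length `r`. -/
structure IsBlockSequence {J : Type*} [LinearOrder J] {D r : ℕ} (β : Fin D → Fin r → J) : Prop where
  strictMono : ∀ j, StrictMono (β j)
  lt : ∀ j j', j < j' → ∀ i i', β j i < β j' i'

/-- The entries of a sequence of tuples, in one row. -/
def flatten {J : Type*} {D r : ℕ} (β : Fin D → Fin r → J) (q : Fin (D * r)) : J :=
  β (finProdFinEquiv.symm q).1 (finProdFinEquiv.symm q).2

@[simp]
theorem flatten_apply {J : Type*} {D r : ℕ} (β : Fin D → Fin r → J) (j : Fin D) (i : Fin r) :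
    flatten β (finProdFinEquiv (j, i)) = β j i := by
  simp [flatten]

variable {J : Type*} [LinearOrder J]

theorem IsBlockSequence.comp {D D' r : ℕ} {β : Fin D → Fin r → J} (h : IsBlockSequence β)
    {f : Fin D' → Fin D} (hf : StrictMono f) : IsBlockSequence (β ∘ f) :=
  ⟨fun j => h.strictMono (f j), fun _ _ hj => h.lt _ _ (hf hj)⟩

theorem IsBlockSequence.strictMono_flatten {D r : ℕ} {β : Fin D → Fin r → J}
    (h : IsBlockSequence β) : StrictMono (flatten β) := by
  intro p q hpq
  obtain ⟨⟨j, i⟩, rfl⟩ := finProdFinEquiv.surjective p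
  obtain ⟨⟨j', i'⟩, rfl⟩ := finProdFinEquiv.surjective q
  rw [flatten_apply, flatten_apply]
  rcases lt_trichotomy j j' with hj | hj | hj
  · exact h.lt _ _ hj _ _
  · subst hj
    refine h.strictMono _ ?_
    rw [Fin.lt_def] at hpq ⊢
    simp only [finProdFinEquiv_apply_val] at hpq
    omega
  · exfalso
    rw [Fin.lt_def] at hpq hj
    simp only [finProdFinEquiv_apply_val] at hpq
    have h1 : r * ((j' : ℕ) + 1) ≤ r * (j : ℕ) := Nat.mul_le_mul le_rfl hj
    have := i'.2
    rw [mul_add] at h1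
    omega

theorem exists_strictMono_fin [Infinite J] (n : ℕ) : ∃ w : Fin n → J, StrictMono w := by
  obtain ⟨s, hs⟩ := Infinite.exists_subset_card_eq J n
  exact ⟨s.orderEmbOfFin hs, (s.orderEmbOfFin hs).strictMono⟩

theorem exists_isBlockSequence [Infinite J] (D r : ℕ) :
    ∃ β : Fin D → Fin r → J, IsBlockSequence β := by
  obtain ⟨w, hw⟩ := exists_strictMono_fin (J := J) (D * r)
  refine ⟨fun j i => w (finProdFinEquiv (j, i)), fun j i i' hi => hw ?_, fun j j' hj i i' => hw ?_⟩
  · rw [Fin.lt_def] at hi ⊢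
    simp only [finProdFinEquiv_apply_val]
    omega
  · rw [Fin.lt_def] at hj ⊢
    simp only [finProdFinEquiv_apply_val]
    have h1 : r * ((j : ℕ) + 1) ≤ r * (j' : ℕ) := Nat.mul_le_mul le_rfl hj
    have := i.2
    rw [mul_add] at h1
    omega

end Blocks

section DpRank

variable {L : FirstOrder.Language.{u, v}} {N : Type w} [L.Structure N]

/-- If none of the mutually indiscernible sequences is indiscernible over `b`, this is witnessed, at
once for all of them and with another element in place of `b`, by two consecutive tuples. -/
theorem IsMutuallyIndiscernible.exists_realizeAt_ne {A : Set N} {X : Type} [Finite X]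
    {J κ : X → Type} [∀ x, LinearOrder (J x)] [∀ x, Infinite (J x)] {a : ∀ x, J x → κ x → N}
    (h : IsMutuallyIndiscernible L A a) {b : N} {r : X → ℕ}
    (φ : ∀ x, L.Formula (↥(insert b A) ⊕ Fin (r x) × κ x)) (s t : ∀ x, Fin (r x) → J x)
    (hs : ∀ x, StrictMono (s x)) (ht : ∀ x, StrictMono (t x))
    (hst : ∀ x, ¬ (RealizeAt (φ x) b (fun p => a x (s x p.1) p.2) ↔
      RealizeAt (φ x) b fun p => a x (t x p.1) p.2))
    (β : ∀ x, Fin 2 → Fin (r x) → J x) (hβ : ∀ x, IsBlockSequence (β x)) :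
    ∃ b', ∀ x, ¬ (RealizeAt (φ x) b' (fun p => a x (β x 0 p.1) p.2) ↔
      RealizeAt (φ x) b' fun p => a x (β x 1 p.1) p.2) := by
  classical
  -- The entries of `s x` and `t x`, in increasing order.
  let F : ∀ x, Finset (J x) := fun x => Finset.univ.image (s x) ∪ Finset.univ.image (t x)
  let p : X → ℕ := fun x => (F x).card
  let w₀ : ∀ x, Fin (p x) ↪o J x := fun x => (F x).orderEmbOfFin rfl
  have hrange : ∀ x, Set.range (w₀ x) = F x := fun x => Finset.range_orderEmbOfFin _ _
  have hs' : ∀ x i, ∃ j, w₀ x j = s x i := fun x i => by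
    have : s x i ∈ Set.range (w₀ x) := by
      rw [hrange]
      simp [F]
    exact this
  have ht' : ∀ x i, ∃ j, w₀ x j = t x i := fun x i => by
    have : t x i ∈ Set.range (w₀ x) := by
      rw [hrange]
      simp [F]
    exact this
  choose s' hs' using hs'
  choose t' ht' using ht'
  have hs'm : ∀ x, StrictMono (s' x) := fun x i i' hi => by
    rw [← (w₀ x).lt_iff_lt, hs', hs']
    exact hs x hi
  have ht'm : ∀ x, StrictMono (t' x) := fun x i i' hi => by
    rw [← (w₀ x).lt_iff_lt, ht', ht']
    exact ht x hi
  -- Move the configuration so that there is room for a tuple to its right.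
  choose w₁ hw₁ using fun x => exists_strictMono_fin (J := J x) (p x + r x)
  obtain ⟨b₁, hb₁⟩ := h.exists_realizeAt (b := b) φ (Q := X × Bool) (l := p) Prod.fst
    (fun q => if q.2 then s' q.1 else t' q.1) {σ | ∀ x, ¬ (σ (x, true) ↔ σ (x, false))}
    (fun x => w₀ x) (fun x i => w₁ x (Fin.castAdd _ i)) (fun x => (w₀ x).strictMono)
    (fun x => (hw₁ x).comp (Fin.strictMono_castAdd _))
    ⟨b, fun x => by simpa [hs', ht'] using hst x⟩
  have hb₁' : ∀ x, ∃ v : Fin (r x) → Fin (p x), StrictMono v ∧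
      ¬ (RealizeAt (φ x) b₁ (fun q => a x (w₁ x (Fin.castAdd _ (v q.1))) q.2) ↔
        RealizeAt (φ x) b₁ fun q => a x (w₁ x (Fin.natAdd _ q.1)) q.2) := by
    intro x
    have := hb₁ x
    simp only [if_true, Bool.false_eq_true, if_false] at this
    by_cases h1 : RealizeAt (φ x) b₁ (fun q => a x (w₁ x (Fin.castAdd _ (s' x q.1))) q.2) ↔
        RealizeAt (φ x) b₁ fun q => a x (w₁ x (Fin.natAdd _ q.1)) q.2
    · refine ⟨t' x, ht'm x, fun h2 => this (h1.trans h2.symm)⟩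
    · exact ⟨s' x, hs'm x, h1⟩
  choose v hv hvne using hb₁'
  let γ : ∀ x, Fin 2 → Fin (r x) → J x := fun x j i =>
    if j = 0 then w₁ x (Fin.castAdd _ (v x i)) else w₁ x (Fin.natAdd _ i)
  have hγ : ∀ x, IsBlockSequence (γ x) := by
    refine fun x => ⟨fun j i i' hi => ?_, fun j j' hj i i' => ?_⟩
    · by_cases hj : j = 0
      · simp only [γ, hj, if_true]
        exact hw₁ x (Fin.strictMono_castAdd _ (hv x hi))
      · simp only [γ, hj, if_false]
        exact hw₁ x (Fin.strictMono_natAdd _ hi)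
    · have h0 : j = 0 := by omega
      have h1 : j' ≠ 0 := by omega
      simp only [γ, h0, h1, if_true, if_false]
      refine hw₁ x ?_
      rw [Fin.lt_def, Fin.val_castAdd, Fin.val_natAdd]
      omega
  obtain ⟨b₂, hb₂⟩ := h.exists_realizeAt (b := b) φ (Q := X × Fin 2) (l := fun x => 2 * r x)
    Prod.fst (fun q i => finProdFinEquiv (q.2, i)) {σ | ∀ x, ¬ (σ (x, 0) ↔ σ (x, 1))}
    (fun x => flatten (γ x)) (fun x => flatten (β x)) (fun x => (hγ x).strictMono_flatten)
    (fun x => (hβ x).strictMono_flatten)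
    ⟨b₁, fun x => by simpa [γ] using hvne x⟩
  exact ⟨b₂, fun x => by simpa using hb₂ x⟩

/-- The number of changes of the truth value of a formula along an indiscernible sequence of tuples
is bounded if there are few types: many changes allow all patterns of truth values. -/
theorem IsMutuallyIndiscernible.exists_card_changes_le {f : ℕ → ℕ} (hf : PolyBounded f)
    (hN : ∀ (E : Finset N) (n : ℕ), E.card ≤ n → ∀ (β : Type) [Fintype β] (b : β → N),
      (∀ x y, x ≠ y → ∃ χ : L.Formula (E ⊕ Unit),
        ¬ (χ.Realize (Sum.elim (fun z : E => (z : N)) fun _ => b x) ↔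
          χ.Realize (Sum.elim (fun z : E => (z : N)) fun _ => b y))) → Fintype.card β ≤ f n)
    {A : Set N} {X : Type} [Finite X]
    {J κ : X → Type} [∀ x, LinearOrder (J x)] [∀ x, Infinite (J x)] {a : ∀ x, J x → κ x → N}
    (h : IsMutuallyIndiscernible L A a) {b : N} {r : X → ℕ}
    (φ : ∀ x, L.Formula (↥(insert b A) ⊕ Fin (r x) × κ x)) (x : X) :
    ∃ K : ℕ, ∀ (l : ℕ) (β : Fin (l + 1) → Fin (r x) → J x), IsBlockSequence β →
      ∀ (b' : N) (S : Finset (Fin l)), (∀ j ∈ S,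
        ¬ (RealizeAt (φ x) b' (fun p => a x (β j.castSucc p.1) p.2) ↔
          RealizeAt (φ x) b' fun p => a x (β j.succ p.1) p.2)) → S.card ≤ K := by
  classical
  obtain ⟨F, hF⟩ := exists_formula_realizeAt (φ x)
  obtain ⟨D, hD⟩ := (hf.comp_affine F.card 0).exists_lt_two_pow
  refine ⟨2 * D, fun l β hβ b' S hS => ?_⟩
  by_contra hcard
  obtain ⟨S', hS', hcard'⟩ := Finset.exists_subset_card_eq (not_le.1 hcard).le
  let o := S'.orderEmbOfFin hcard'
  have ho : ∀ i, o i ∈ S := fun i => hS' (Finset.orderEmbOfFin_mem _ _ _)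
  choose γ hγ using fun y => exists_isBlockSequence (J := J y) D (r y)
  -- All patterns of truth values are realized along `γ x`.
  have hpat : ∀ s : Set (Fin D), ∃ c, ∀ i,
      RealizeAt (φ x) c (fun p => a x (γ x i p.1) p.2) ↔ i ∈ s := by
    intro s
    have hidx : ∀ i : Fin D, ∃ j : Fin (l + 1),
        ((o ⟨2 * i, by omega⟩ : Fin l) : ℕ) ≤ j ∧ (j : ℕ) ≤ (o ⟨2 * i, by omega⟩ : Fin l) + 1 ∧
        (RealizeAt (φ x) b' (fun p => a x (β j p.1) p.2) ↔ i ∈ s) := by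
      intro i
      have h1 := hS _ (ho ⟨2 * i, by omega⟩)
      by_cases h2 : RealizeAt (φ x) b'
          (fun p => a x (β (o ⟨2 * i, by omega⟩).castSucc p.1) p.2) ↔ i ∈ s
      · exact ⟨_, le_rfl, Nat.le_succ _, h2⟩
      · refine ⟨(o ⟨2 * i, by omega⟩).succ, by simp, by simp, ?_⟩
        tauto
    choose idx hidx1 hidx2 hidx using hidx
    have hmono : StrictMono idx := by
      intro i i' hi
      rw [Fin.lt_def] at hi ⊢
      have h1 : o ⟨2 * i, by omega⟩ < o ⟨2 * i + 1, by omega⟩ := o.strictMono (by simp [Fin.lt_def])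
      have h2 : o ⟨2 * i + 1, by omega⟩ < o ⟨2 * i', by omega⟩ :=
        o.strictMono (by rw [Fin.lt_def]; simp only; omega)
      have := hidx2 i
      have := hidx1 i'
      rw [Fin.lt_def] at h1 h2
      omega
    have hβi := hβ.comp hmono
    obtain ⟨c, hc⟩ := h.exists_realizeAt (b := b) φ (Q := Fin D) (l := fun y => D * r y)
      (fun _ => x) (fun q i => finProdFinEquiv (q, i)) {σ | ∀ i, σ i ↔ i ∈ s}
      (Function.update (fun y => flatten (γ y)) x (flatten (β ∘ idx))) (fun y => flatten (γ y))
      (fun y => by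
        by_cases hy : y = x
        · subst hy
          simpa using hβi.strictMono_flatten
        · simpa [hy] using (hγ y).strictMono_flatten)
      (fun y => (hγ y).strictMono_flatten)
      ⟨b', fun i => by simpa using hidx i⟩
    exact ⟨c, fun i => by simpa using hc i⟩
  choose c hc using hpat
  let E : Finset N := Finset.univ.image fun q : Fin D × F =>
    Sum.elim (fun z : ↥(insert b A) => (z : N))
      (fun p : Fin (r x) × κ x => a x (γ x q.1 p.1) p.2) q.2.1
  have hE : E.card ≤ F.card * D + 0 := by
    refine Finset.card_image_le.trans ?_
    simp [mul_comm]
  have := hN E _ hE (Set (Fin D)) c fun s t hst => by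
    obtain ⟨i, hi⟩ : ∃ i, ¬ (i ∈ s ↔ i ∈ t) := by
      by_contra! hne
      exact hst (Set.ext hne)
    obtain ⟨χ, hχ⟩ := hF (fun p => a x (γ x i p.1) p.2) E fun v hv =>
      Finset.mem_image.2 ⟨(i, ⟨v, hv⟩), Finset.mem_univ _, rfl⟩
    exact ⟨χ, by rwa [hχ, hχ, hc, hc]⟩
  have h2 := this.trans_lt hD
  simp at h2

end DpRank

section DpRankBound

variable {L : FirstOrder.Language.{u, v}}

/-- If `k + 1` mutually indiscernible sequences all fail to be indiscernible over an element, then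
over a set of linear size in `l` there are at least `l ^ (k + 1)` types up to a constant factor: one
for each choice of a place in every sequence where the truth value changes. -/
theorem HasPolyOrbits.dpRankLT {M : Type*} [L.Structure M] {k : ℕ} (h : HasPolyOrbits L M k) :
    DpRankLT (L.completeTheory M) (Fin (k + 1)) := by
  classical
  intro N A J κ _ _ a ha b
  by_contra! hcon
  obtain ⟨C, hC⟩ := h
  have : Nonempty N := N.nonempty'
  have hcount : ∀ (E : Finset N) (n : ℕ), E.card ≤ n → ∀ (β : Type) [Fintype β] (b : β → N),
      (∀ x y, x ≠ y → ∃ χ : L.Formula (E ⊕ Unit),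
        ¬ (χ.Realize (Sum.elim (fun z : E => (z : N)) fun _ => b x) ↔
          χ.Realize (Sum.elim (fun z : E => (z : N)) fun _ => b y))) →
      Fintype.card β ≤ C * (n + 1) ^ k := fun E n hE β _ b hb =>
    (card_le_of_distinguished hC N.is_model E b hb).trans
      (Nat.mul_le_mul le_rfl (Nat.pow_le_pow_left (Nat.succ_le_succ hE) _))
  have hwit : ∀ x, ∃ (r : ℕ) (φ : L.Formula (↥(insert b A) ⊕ Fin r × κ x)) (s t : Fin r → J x),
      StrictMono s ∧ StrictMono t ∧
      ¬ (RealizeAt φ b (fun p => a x (s p.1) p.2) ↔ RealizeAt φ b fun p => a x (t p.1) p.2) := by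
    intro x
    have := hcon x
    unfold IsIndiscernible at this
    push Not at this
    obtain ⟨r, φ, s, t, hs, ht, hst⟩ := this
    refine ⟨r, φ, s, t, hs, ht, ?_⟩
    rw [realizeAt_self, realizeAt_self]
    tauto
  choose r φ s t hs ht hst using hwit
  choose K hK using ha.exists_card_changes_le (f := fun n => C * (n + 1) ^ k) ⟨C, k, fun _ => le_rfl⟩
    hcount φ
  choose F hF using fun x => exists_formula_realizeAt (φ x)
  let c := ∑ x, (F x).card
  let P := ∏ x, K x
  -- A number of blocks that contradicts the polynomial bound.
  let l := P * (C * (2 * c + 1) ^ k) + 1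
  choose β hβ using fun x => exists_isBlockSequence (J := J x) (l + 1) (r x)
  have hη : ∀ η : Fin (k + 1) → Fin l, ∃ b', ∀ x,
      ¬ (RealizeAt (φ x) b' (fun p => a x (β x (η x).castSucc p.1) p.2) ↔
        RealizeAt (φ x) b' fun p => a x (β x (η x).succ p.1) p.2) := by
    intro η
    have hm : ∀ x, StrictMono (![(η x).castSucc, (η x).succ] : Fin 2 → Fin (l + 1)) := fun x => by
      refine Fin.strictMono_iff_lt_succ.2 fun i => ?_
      rw [Fin.fin_one_eq_zero i]
      exact Fin.castSucc_lt_succ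
    obtain ⟨b', hb'⟩ := ha.exists_realizeAt_ne φ s t hs ht hst
      (fun x => β x ∘ ![(η x).castSucc, (η x).succ]) fun x => (hβ x).comp (hm x)
    exact ⟨b', fun x => by simpa using hb' x⟩
  choose b' hb' using hη
  let tr : N → ∀ _ : Fin (k + 1), Fin (l + 1) → Prop := fun z x j =>
    RealizeAt (φ x) z fun p => a x (β x j p.1) p.2
  let 𝒯 : Finset (∀ _ : Fin (k + 1), Fin (l + 1) → Prop) := Finset.univ.image fun η => tr (b' η)
  have hfib : Fintype.card (Fin (k + 1) → Fin l) ≤ P * 𝒯.card := by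
    refine Finset.card_le_mul_card_image Finset.univ P fun τ hτ => ?_
    let S : Fin (k + 1) → Finset (Fin l) := fun x =>
      Finset.univ.filter fun j => ¬ (τ x j.castSucc ↔ τ x j.succ)
    have hsub : (Finset.univ.filter fun η => tr (b' η) = τ) ⊆ Fintype.piFinset S := by
      intro η hη
      rw [Finset.mem_filter] at hη
      rw [Fintype.mem_piFinset]
      intro x
      simp only [S, Finset.mem_filter, Finset.mem_univ, true_and]
      rw [← hη.2]
      exact hb' η x
    refine (Finset.card_le_card hsub).trans ?_
    rw [Fintype.card_piFinset]
    refine Finset.prod_le_prod' fun x _ => ?_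
    obtain ⟨η, -, rfl⟩ := Finset.mem_image.1 hτ
    exact hK x l (β x) (hβ x) (b' η) (S x) fun j hj => (Finset.mem_filter.1 hj).2
  let E : Finset N := Finset.univ.biUnion fun x =>
    Finset.univ.image fun q : Fin (l + 1) × F x =>
      Sum.elim (fun z : ↥(insert b A) => (z : N))
        (fun p : Fin (r x) × κ x => a x (β x q.1 p.1) p.2) q.2.1
  have hE : E.card ≤ (l + 1) * c := by
    refine Finset.card_biUnion_le.trans ?_
    rw [Finset.mul_sum]
    refine Finset.sum_le_sum fun x _ => Finset.card_image_le.trans (by simp)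
  have hrep : ∀ τ : 𝒯, ∃ z, tr z = τ := fun τ => by
    obtain ⟨η, -, hη⟩ := Finset.mem_image.1 τ.2
    exact ⟨_, hη⟩
  choose z hz using hrep
  have h𝒯 : 𝒯.card ≤ C * ((l + 1) * c + 1) ^ k := by
    rw [← Fintype.card_coe]
    refine hcount E _ hE 𝒯 z fun τ τ' hne => ?_
    obtain ⟨x, j, hj⟩ : ∃ x j, ¬ (τ.1 x j ↔ τ'.1 x j) := by
      by_contra! hall
      exact hne (Subtype.ext (funext fun x => funext fun j => propext (hall x j)))
    obtain ⟨χ, hχ⟩ := hF x (fun p => a x (β x j p.1) p.2) E fun v hv =>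
      Finset.mem_biUnion.2 ⟨x, Finset.mem_univ _, Finset.mem_image.2
        ⟨(j, ⟨v, hv⟩), Finset.mem_univ _, rfl⟩⟩
    refine ⟨χ, ?_⟩
    rw [hχ, hχ]
    rw [← hz τ, ← hz τ'] at hj
    exact hj
  have hl : (l + 1) * c + 1 ≤ (2 * c + 1) * l := by
    have : 1 ≤ l := Nat.succ_le_succ (Nat.zero_le _)
    nlinarith
  have hfinal : l ^ (k + 1) ≤ (P * (C * (2 * c + 1) ^ k)) * l ^ k :=
    calc l ^ (k + 1) = Fintype.card (Fin (k + 1) → Fin l) := by simp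
      _ ≤ P * 𝒯.card := hfib
      _ ≤ P * (C * ((l + 1) * c + 1) ^ k) := Nat.mul_le_mul le_rfl h𝒯
      _ ≤ P * (C * ((2 * c + 1) * l) ^ k) :=
        Nat.mul_le_mul le_rfl (Nat.mul_le_mul le_rfl (Nat.pow_le_pow_left hl k))
      _ = _ := by rw [mul_pow]; ring
  rw [pow_succ, mul_comm] at hfinal
  have := Nat.le_of_mul_le_mul_right hfinal (Nat.pow_pos (Nat.succ_pos _))
  omega

end DpRankBound

/-! ### Meet-trees with relations on the open cones -/

/-- A meet-tree in which every center `x` carries relations `rel R x` on the set of open cones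
above `x`, given as relations between the elements above `x`. -/
structure ConeTree (L : FirstOrder.Language.{u, v}) (M : Type w) [SemilatticeInf M] where
  le_or_le : ∀ {x y z : M}, y ≤ x → z ≤ x → y ≤ z ∨ z ≤ y
  rel : ∀ {n : ℕ}, L.Relations n → M → (Fin n → M) → Prop
  rel_congr : ∀ {n : ℕ} {R : L.Relations n} {x : M} {y y' : Fin n → M},
    rel R x y → (∀ i, x < y i ⊓ y' i) → rel R x y'
  lt_of_rel : ∀ {n : ℕ} {R : L.Relations n} {x : M} {y : Fin n → M}, rel R x y → ∀ i, x < y i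

namespace ConeTree

/-- The tuple `e` together with the element `b`. -/
def adjoin {M ι : Type*} (e : ι → M) (b : M) (o : Option ι) : M :=
  o.elim b e

@[simp] theorem adjoin_none {M ι : Type*} (e : ι → M) (b : M) : adjoin e b none = b := rfl

@[simp] theorem adjoin_some {M ι : Type*} (e : ι → M) (b : M) (i : ι) : adjoin e b (some i) = e i :=
  rfl

variable {L : FirstOrder.Language.{u, v}} {M : Type w} [SemilatticeInf M] (𝒯 : ConeTree L M)

/-- The tuples `d` and `d'` satisfy the same atomic formulas. All meets of entries are meets of two
entries, and the relations only depend on open cones, so that it is enough to compare the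
instances below. -/
structure SameAtoms {V : Type*} (d d' : V → M) : Prop where
  inf_le_iff : ∀ i j k, d i ⊓ d j ≤ d k ↔ d' i ⊓ d' j ≤ d' k
  rel_iff : ∀ {n : ℕ} (R : L.Relations n) (i j : V) (f : Fin n → V),
    𝒯.rel R (d i ⊓ d j) (fun m => d (f m)) ↔ 𝒯.rel R (d' i ⊓ d' j) fun m => d' (f m)

/-- The place where `b` branches off the tree spanned by `e`: the branching point is
`e i₀ ⊓ b`, and `e i₁ ⊓ e i₀` is the least element of the form `e i ⊓ e i₀` above it. -/
structure IsPlace {ι : Type*} (e : ι → M) (b : M) (i₀ i₁ : ι) : Prop where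
  inf_le : ∀ i, e i ⊓ b ≤ e i₀
  le : e i₀ ⊓ b ≤ e i₁
  least : ∀ i, e i₀ ⊓ b ≤ e i → e i₁ ⊓ e i₀ ≤ e i

theorem exists_isPlace (𝒯 : ConeTree L M) {ι : Type*} [Finite ι] [Nonempty ι] (e : ι → M) (b : M) :
    ∃ i₀ i₁, IsPlace e b i₀ i₁ := by
  obtain ⟨_, ⟨i₀, rfl⟩, hmax⟩ := (Set.finite_range fun i => e i ⊓ b).exists_maximal
    (Set.range_nonempty _)
  have h₀ : ∀ i, e i ⊓ b ≤ e i₀ ⊓ b := fun i =>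
    (𝒯.le_or_le (inf_le_right : e i ⊓ b ≤ b) (inf_le_right : e i₀ ⊓ b ≤ b)).elim
      _root_.id fun h => hmax ⟨i, rfl⟩ h
  obtain ⟨_, ⟨i₁, hi₁, rfl⟩, hmin⟩ :=
    ((Set.toFinite {i | e i₀ ⊓ b ≤ e i}).image fun i => e i ⊓ e i₀).exists_minimal
      (Set.Nonempty.image _ ⟨i₀, inf_le_left⟩)
  refine ⟨i₀, i₁, fun i => (h₀ i).trans inf_le_left, hi₁, fun i hi => ?_⟩
  have h₁ : e i₁ ⊓ e i₀ ≤ e i ⊓ e i₀ :=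
    (𝒯.le_or_le (inf_le_right : e i₁ ⊓ e i₀ ≤ e i₀) (inf_le_right : e i ⊓ e i₀ ≤ e i₀)).elim
      _root_.id fun h => hmin ⟨i, hi, rfl⟩ h
  exact h₁.trans inf_le_left

namespace IsPlace

variable {𝒯} {ι : Type*} {e : ι → M} {b : M} {i₀ i₁ : ι}

theorem branch_le (h : IsPlace e b i₀ i₁) : e i₀ ⊓ b ≤ e i₁ ⊓ e i₀ :=
  le_inf h.le inf_le_left

theorem branch_le_iff (h : IsPlace e b i₀ i₁) (i : ι) :
    e i₀ ⊓ b ≤ e i ↔ e i₁ ⊓ e i₀ ≤ e i :=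
  ⟨h.least i, h.branch_le.trans⟩

theorem inf_eq_branch (h : IsPlace e b i₀ i₁) {i : ι} (hi : e i₁ ⊓ e i₀ ≤ e i) :
    e i ⊓ b = e i₀ ⊓ b :=
  le_antisymm (le_inf (h.inf_le i) inf_le_right) (le_inf ((h.branch_le_iff i).2 hi) inf_le_right)

theorem inf_eq_inf (𝒯 : ConeTree L M) (h : IsPlace e b i₀ i₁) {i : ι} (hi : ¬ e i₁ ⊓ e i₀ ≤ e i) :
    e i ⊓ b = e i ⊓ e i₀ := by
  refine le_antisymm (le_inf inf_le_left (h.inf_le i)) (le_inf inf_le_left ?_)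
  have h1 : e i ⊓ e i₀ ≤ e i₀ ⊓ b :=
    (𝒯.le_or_le (inf_le_right : e i ⊓ e i₀ ≤ e i₀) (inf_le_left : e i₀ ⊓ b ≤ e i₀)).elim
      _root_.id fun h2 => (hi (h.least i (h2.trans inf_le_left))).elim
  exact h1.trans inf_le_right

theorem inf_branch_eq (h : IsPlace e b i₀ i₁) {i j : ι} (hx : e i ⊓ e j = e i₀ ⊓ b) :
    e i ⊓ e j = e i₁ ⊓ e i₀ :=
  le_antisymm (hx.le.trans h.branch_le)
    (le_inf (h.least i (hx.ge.trans inf_le_left)) (h.least j (hx.ge.trans inf_le_right)))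

theorem le_iff (h : IsPlace e b i₀ i₁) (i : ι) :
    b ≤ e i ↔ b ≤ e i₀ ∧ e i₁ ⊓ e i₀ ≤ e i := by
  constructor
  · intro hb
    exact ⟨(le_inf hb le_rfl).trans (h.inf_le i), h.least i (inf_le_right.trans hb)⟩
  · rintro ⟨h1, h2⟩
    exact (le_inf h1 le_rfl).trans ((h.branch_le_iff i).2 h2)

theorem inf_le_iff (𝒯 : ConeTree L M) (h : IsPlace e b i₀ i₁) (i k : ι) :
    e i ⊓ b ≤ e k ↔
      (e i₁ ⊓ e i₀ ≤ e i → e i₁ ⊓ e i₀ ≤ e k) ∧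
        (¬ e i₁ ⊓ e i₀ ≤ e i → e i ⊓ e i₀ ≤ e k) := by
  by_cases hi : e i₁ ⊓ e i₀ ≤ e i
  · rw [h.inf_eq_branch hi, h.branch_le_iff]
    tauto
  · rw [inf_eq_inf 𝒯 h hi]
    tauto

theorem inf_le_right_iff (𝒯 : ConeTree L M) (h : IsPlace e b i₀ i₁) (i j : ι) :
    e i ⊓ e j ≤ b ↔ e i ⊓ e j ≤ e i₀ ∧ (e i₁ ⊓ e i₀ ≤ e i →
      (e i₁ ⊓ e i₀ ≤ b → e i ⊓ e j ≤ e i₁ ⊓ e i₀) ∧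
        (¬ e i₁ ⊓ e i₀ ≤ b → e i ⊓ e j < e i₁ ⊓ e i₀)) := by
  constructor
  · intro hb
    have h1 : e i ⊓ e j ≤ e i₀ ⊓ b :=
      le_inf ((le_inf inf_le_left hb).trans (h.inf_le i)) hb
    refine ⟨h1.trans inf_le_left, fun _ => ⟨fun _ => h1.trans h.branch_le, fun hg => ?_⟩⟩
    refine lt_of_le_of_ne (h1.trans h.branch_le) fun heq => hg ?_
    exact heq ▸ hb
  · rintro ⟨h0, h1⟩
    by_cases hi : e i₁ ⊓ e i₀ ≤ e i
    · by_cases hg : e i₁ ⊓ e i₀ ≤ b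
      · exact ((h1 hi).1 hg).trans hg
      · have hlt := (h1 hi).2 hg
        -- Otherwise `e i ⊓ e j` lies above the branching point, hence above `e i₁ ⊓ e i₀`.
        rcases 𝒯.le_or_le h0 (inf_le_left : e i₀ ⊓ b ≤ e i₀) with h2 | h2
        · exact h2.trans inf_le_right
        · exact (hlt.not_ge (le_inf (h.least i (h2.trans inf_le_left))
            (h.least j (h2.trans inf_le_right)))).elim
    · have h2 : e i ⊓ e j ≤ e i ⊓ e i₀ := le_inf inf_le_left h0
      rw [← inf_eq_inf 𝒯 h hi] at h2
      exact h2.trans inf_le_right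

end IsPlace

/-- The finite data that determine the atomic formulas satisfied by `b` over `e`: the place of `b`,
whether the branching point is one of the meets of `e` and whether it is `b` itself, the relations
between `b` and `e i₀` at the branching point, the relations without arguments at `b`, and the
relations at the center `e i₁ ⊓ e i₀`. -/
structure SameCode {ι : Type*} (e : ι → M) (i₀ i₁ : ι) (b b' : M) : Prop where
  left : IsPlace e b i₀ i₁
  right : IsPlace e b' i₀ i₁
  branch_mem : e i₁ ⊓ e i₀ ≤ b ↔ e i₁ ⊓ e i₀ ≤ b'
  le_iff : b ≤ e i₀ ↔ b' ≤ e i₀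
  rel_branch : ∀ {n : ℕ} (R : L.Relations n) (P : Fin n → Bool),
    𝒯.rel R (e i₀ ⊓ b) (fun m => if P m then b else e i₀) ↔
      𝒯.rel R (e i₀ ⊓ b') fun m => if P m then b' else e i₀
  rel_self : ∀ {n : ℕ} (R : L.Relations n), 𝒯.rel R b (fun _ => b) ↔ 𝒯.rel R b' fun _ => b'
  rel_inf : ∀ {n : ℕ} (R : L.Relations n) (P : Fin n → Bool) (y : Fin n → ι),
    𝒯.rel R (e i₁ ⊓ e i₀) (fun m => if P m then b else e (y m)) ↔
      𝒯.rel R (e i₁ ⊓ e i₀) fun m => if P m then b' else e (y m)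

namespace SameCode

variable {𝒯} {ι : Type*} {e : ι → M} {b b' : M} {i₀ i₁ : ι}

theorem symm (h : 𝒯.SameCode e i₀ i₁ b b') : 𝒯.SameCode e i₀ i₁ b' b :=
  ⟨h.right, h.left, h.branch_mem.symm, h.le_iff.symm, fun R P => (h.rel_branch R P).symm,
    fun R => (h.rel_self R).symm, fun R P y => (h.rel_inf R P y).symm⟩

theorem le_iff' (h : 𝒯.SameCode e i₀ i₁ b b') (i : ι) : b ≤ e i ↔ b' ≤ e i := by
  rw [h.left.le_iff, h.right.le_iff, h.le_iff]

theorem inf_le_iff (h : 𝒯.SameCode e i₀ i₁ b b') (i j : ι) :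
    e i ⊓ e j ≤ b ↔ e i ⊓ e j ≤ b' := by
  rw [h.left.inf_le_right_iff 𝒯, h.right.inf_le_right_iff 𝒯, h.branch_mem]

/-- The branching point is a meet of `e` for both elements or for none. -/
theorem branch_eq_iff (h : 𝒯.SameCode e i₀ i₁ b b') :
    e i₀ ⊓ b = e i₁ ⊓ e i₀ ↔ e i₁ ⊓ e i₀ ≤ b :=
  ⟨fun heq => heq ▸ inf_le_right, fun hg => le_antisymm h.left.branch_le (le_inf inf_le_right hg)⟩

theorem rel_of_rel_inf (h : 𝒯.SameCode e i₀ i₁ b b') {n : ℕ} {R : L.Relations n} {i j : ι}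
    {f : Fin n → Option ι} (hR : 𝒯.rel R (e i ⊓ e j) fun m => adjoin e b (f m)) :
    𝒯.rel R (e i ⊓ e j) fun m => adjoin e b' (f m) := by
  by_cases hf : ∃ m, f m = none
  · obtain ⟨m₀, hm₀⟩ := hf
    have hb : e i ⊓ e j < b := by simpa [hm₀] using 𝒯.lt_of_rel hR m₀
    have hxb' : e i ⊓ e j ≤ b' := (h.inf_le_iff i j).1 hb.le
    have hle : e i ⊓ e j ≤ e i₀ ⊓ b :=
      le_inf ((le_inf inf_le_left hb.le).trans (h.left.inf_le i)) hb.le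
    have hle' : e i ⊓ e j ≤ e i₀ ⊓ b' :=
      le_inf ((le_inf inf_le_left hxb').trans (h.right.inf_le i)) hxb'
    by_cases hx : e i ⊓ e j = e i₀ ⊓ b
    · rw [h.left.inf_branch_eq hx] at hR ⊢
      have key : ∀ b : M, (fun m => adjoin e b (f m)) =
          fun m => if (f m).isNone then b else e ((f m).getD i₀) := by
        intro b
        funext m
        cases f m <;> simp
      rw [key] at hR ⊢
      exact (h.rel_inf R (fun m => (f m).isNone) fun m => (f m).getD i₀).1 hR
    · have hlt : e i ⊓ e j < e i₀ ⊓ b := lt_of_le_of_ne hle hx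
      have hlt' : e i ⊓ e j < e i₀ ⊓ b' := by
        refine lt_of_le_of_ne hle' fun hx' => hx ?_
        have h1 := h.right.inf_branch_eq hx'
        have h2 : e i₁ ⊓ e i₀ ≤ b' := h1 ▸ hxb'
        rw [h1, h.branch_eq_iff.2 (h.branch_mem.2 h2)]
      have h1 : 𝒯.rel R (e i ⊓ e j) fun m => adjoin e (e i₀) (f m) := by
        refine 𝒯.rel_congr hR fun m => ?_
        have := 𝒯.lt_of_rel hR m
        cases hm : f m with
        | none => simpa [inf_comm] using hlt
        | some k => simpa [hm] using this
      refine 𝒯.rel_congr h1 fun m => ?_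
      have := 𝒯.lt_of_rel h1 m
      cases hm : f m with
      | none => simpa using hlt'
      | some k => simpa [hm] using this
  · push Not at hf
    have : (fun m => adjoin e b (f m)) = fun m => adjoin e b' (f m) := by
      funext m
      obtain ⟨k, hk⟩ := Option.ne_none_iff_exists'.1 (hf m)
      simp [hk]
    rwa [← this]

theorem rel_of_rel_branch (h : 𝒯.SameCode e i₀ i₁ b b') {n : ℕ} {R : L.Relations n}
    {f : Fin n → Option ι} (hR : 𝒯.rel R (e i₀ ⊓ b) fun m => adjoin e b (f m)) :
    𝒯.rel R (e i₀ ⊓ b') fun m => adjoin e b' (f m) := by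
  by_cases hg : e i₁ ⊓ e i₀ ≤ b
  · rw [h.branch_eq_iff.2 hg] at hR
    rw [h.symm.branch_eq_iff.2 (h.branch_mem.1 hg)]
    exact h.rel_of_rel_inf hR
  · have hlt : e i₀ ⊓ b < e i₁ ⊓ e i₀ :=
      lt_of_le_of_ne h.left.branch_le fun heq => hg (h.branch_eq_iff.1 heq)
    have hlt' : e i₀ ⊓ b' < e i₁ ⊓ e i₀ :=
      lt_of_le_of_ne h.right.branch_le fun heq =>
        hg (h.branch_mem.2 (h.symm.branch_eq_iff.1 heq))
    have hsome : ∀ m k, f m = some k → e i₁ ⊓ e i₀ ≤ e k := fun m k hm => by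
      have := 𝒯.lt_of_rel hR m
      rw [hm] at this
      exact h.left.least k this.le
    have h1 : 𝒯.rel R (e i₀ ⊓ b) fun m => if (f m).isNone then b else e i₀ := by
      refine 𝒯.rel_congr hR fun m => ?_
      have := 𝒯.lt_of_rel hR m
      cases hm : f m with
      | none => simpa [hm] using this
      | some k => simpa using hlt.trans_le (le_inf (hsome m k hm) inf_le_right)
    have h2 := (h.rel_branch R fun m => (f m).isNone).1 h1
    refine 𝒯.rel_congr h2 fun m => ?_
    have := 𝒯.lt_of_rel h2 m
    cases hm : f m with
    | none => simpa [hm] using this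
    | some k => simpa using hlt'.trans_le (le_inf inf_le_right (hsome m k hm))

theorem rel_of_rel_self (h : 𝒯.SameCode e i₀ i₁ b b') {n : ℕ} {R : L.Relations n}
    {f : Fin n → Option ι} (hR : 𝒯.rel R b fun m => adjoin e b (f m)) :
    𝒯.rel R b' fun m => adjoin e b' (f m) := by
  by_cases hb : b ≤ e i₀
  · have h1 : e i₀ ⊓ b = b := inf_eq_right.2 hb
    have h2 : e i₀ ⊓ b' = b' := inf_eq_right.2 (h.le_iff.1 hb)
    have := h.rel_of_rel_branch (R := R) (f := f) (by rwa [h1])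
    rwa [h2] at this
  -- Otherwise nothing among `e` and `b` lies above `b`, so that `R` has no arguments.
  · have hn : IsEmpty (Fin n) := ⟨fun m => by
      have := 𝒯.lt_of_rel hR m
      cases hm : f m with
      | none => simp [hm] at this
      | some k =>
        rw [hm] at this
        exact hb ((le_inf this.le le_rfl).trans (h.left.inf_le k))⟩
    have h1 : ∀ y y' : Fin n → M, y = y' := fun y y' => Subsingleton.elim _ _
    rw [h1 (fun m => adjoin e b (f m)) fun _ => b] at hR
    rw [h1 (fun m => adjoin e b' (f m)) fun _ => b']
    exact (h.rel_self R).1 hR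

theorem rel_of_rel (h : 𝒯.SameCode e i₀ i₁ b b') {n : ℕ} {R : L.Relations n} {i j : Option ι}
    {f : Fin n → Option ι} (hR : 𝒯.rel R (adjoin e b i ⊓ adjoin e b j) fun m => adjoin e b (f m)) :
    𝒯.rel R (adjoin e b' i ⊓ adjoin e b' j) fun m => adjoin e b' (f m) := by
  have hmixed : ∀ i, 𝒯.rel R (e i ⊓ b) (fun m => adjoin e b (f m)) →
      𝒯.rel R (e i ⊓ b') fun m => adjoin e b' (f m) := by
    intro i hR
    by_cases hi : e i₁ ⊓ e i₀ ≤ e i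
    · rw [h.left.inf_eq_branch hi] at hR
      rw [h.right.inf_eq_branch hi]
      exact h.rel_of_rel_branch hR
    · rw [h.left.inf_eq_inf 𝒯 hi] at hR
      rw [h.right.inf_eq_inf 𝒯 hi]
      exact h.rel_of_rel_inf hR
  rcases i with _ | i <;> rcases j with _ | j <;> simp only [adjoin_none, adjoin_some] at hR ⊢
  · rw [inf_idem] at hR ⊢
    exact h.rel_of_rel_self hR
  · rw [inf_comm] at hR ⊢
    exact hmixed j hR
  · exact hmixed i hR
  · exact h.rel_of_rel_inf hR

theorem sameAtoms (h : 𝒯.SameCode e i₀ i₁ b b') : 𝒯.SameAtoms (adjoin e b) (adjoin e b') := by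
  refine ⟨fun i j k => ?_, fun R i j f => ⟨h.rel_of_rel, h.symm.rel_of_rel⟩⟩
  have hmixed : ∀ i k, e i ⊓ b ≤ e k ↔ e i ⊓ b' ≤ e k := fun i k => by
    rw [h.left.inf_le_iff 𝒯, h.right.inf_le_iff 𝒯]
  rcases i with _ | i <;> rcases j with _ | j <;> rcases k with _ | k <;>
    simp only [adjoin_none, adjoin_some, inf_idem, le_refl, inf_le_left, inf_le_right]
  · exact h.le_iff' k
  · rw [inf_comm, inf_comm b']
    exact hmixed j k
  · exact hmixed i k
  · exact h.inf_le_iff i j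

end SameCode

/-- If at every center there are few possibilities for the relations between an element and a finite
tuple, then there are few possibilities for the atomic formulas satisfied by an element over a
finite tuple. -/
theorem exists_polyBounded_sameAtoms [Finite (Σ n, L.Relations n)]
    {t : (Σ n, L.Relations n) → ℕ → ℕ} (ht : ∀ R, PolyBounded (t R))
    (h : ∀ (R : Σ n, L.Relations n) (P : Fin R.1 → Bool) (ι : Type) [Fintype ι] (e : ι → M) (g : M),
      AtMostClasses (fun b b' => ∀ y : Fin R.1 → ι,
        𝒯.rel R.2 g (fun m => if P m then b else e (y m)) ↔
          𝒯.rel R.2 g fun m => if P m then b' else e (y m)) (t R (Fintype.card ι))) :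
    ∃ f : ℕ → ℕ, PolyBounded f ∧ ∀ (ι : Type) [Fintype ι] [Nonempty ι] (e : ι → M),
      AtMostClasses (fun b b' => 𝒯.SameAtoms (adjoin e b) (adjoin e b')) (f (Fintype.card ι)) := by
  classical
  have := Fintype.ofFinite (Σ n, L.Relations n)
  obtain ⟨c₁, hc₁⟩ : ∃ c, ∀ F : M → ∀ R : Σ n, L.Relations n, (Fin R.1 → Bool) → Prop,
    AtMostClasses (fun b b' => F b = F b') c := ⟨_, fun F => AtMostClasses.of_map F⟩
  obtain ⟨c₂, hc₂⟩ : ∃ c, ∀ F : M → (Σ n, L.Relations n) → Prop,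
    AtMostClasses (fun b b' => F b = F b') c := ⟨_, fun F => AtMostClasses.of_map F⟩
  obtain ⟨c₃, hc₃⟩ : ∃ c, ∀ F : M → Prop,
    AtMostClasses (fun b b' => F b = F b') c := ⟨_, fun F => AtMostClasses.of_map F⟩
  have hpoly : PolyBounded fun n => (n * n) *
      (c₃ * (c₃ * (c₁ * (c₂ * ∏ R, ∏ _P : Fin R.1 → Bool, t R n)))) := by
    refine (PolyBounded.id.mul .id).mul ?_
    refine (PolyBounded.const c₃).mul ((PolyBounded.const c₃).mul
      ((PolyBounded.const c₁).mul ((PolyBounded.const c₂).mul ?_)))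
    exact PolyBounded.prod _ fun R => PolyBounded.prod _ fun _ => ht R
  refine ⟨_, hpoly, fun ι _ _ e => ?_⟩
  choose i₀ i₁ hplace using 𝒯.exists_isPlace e
  have h0 : AtMostClasses (fun b b' => (i₀ b, i₁ b) = (i₀ b', i₁ b'))
      (Fintype.card ι * Fintype.card ι) := by
    simpa using AtMostClasses.of_map fun b => (i₀ b, i₁ b)
  have htrace : ∀ g : M, AtMostClasses (fun b b' => ∀ (R : Σ n, L.Relations n) (P : Fin R.1 → Bool)
      (y : Fin R.1 → ι), 𝒯.rel R.2 g (fun m => if P m then b else e (y m)) ↔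
        𝒯.rel R.2 g fun m => if P m then b' else e (y m))
      (∏ R, ∏ _P : Fin R.1 → Bool, t R (Fintype.card ι)) := fun g =>
    AtMostClasses.forall_fintype fun R =>
      AtMostClasses.forall_fintype (J := Fin R.1 → Bool) fun P => h R P ι e g
  have h1 := h0.bind fun z : ι × ι =>
    (hc₃ fun b => e z.2 ⊓ e z.1 ≤ b).and <|
    (hc₃ fun b => b ≤ e z.1).and <|
    (hc₁ fun b R P => 𝒯.rel R.2 (e z.1 ⊓ b) fun m => if P m then b else e z.1).and <|
    (hc₂ fun b R => 𝒯.rel R.2 b fun _ => b).and <|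
    htrace (e z.2 ⊓ e z.1)
  refine h1.mono ?_ le_rfl
  rintro b b' ⟨hz, hp, hq, hR, hB, hg⟩
  obtain ⟨hz₀, hz₁⟩ := Prod.ext_iff.1 hz
  have hright := hplace b'
  simp only at hz₀ hz₁
  rw [← hz₀, ← hz₁] at hright
  exact SameCode.sameAtoms (i₀ := i₀ b) (i₁ := i₁ b) ⟨hplace b, hright, iff_of_eq hp, iff_of_eq hq,
    fun {n} R P => iff_of_eq (congrFun (congrFun hR ⟨n, R⟩) P),
    fun {n} R => iff_of_eq (congrFun hB ⟨n, R⟩), fun {n} R P y => hg ⟨n, R⟩ P y⟩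

end ConeTree

/-! ### Universal theories -/

section Universal

variable {L : FirstOrder.Language.{u, v}} {α : Type*}

theorem isUniversal_alls {n : ℕ} {φ : L.BoundedFormula α n} (h : φ.IsUniversal) :
    BoundedFormula.IsUniversal φ.alls := by
  induction n with
  | zero => exact h
  | succ n ih => exact ih h.all

theorem isQF_iInf {n : ℕ} {β : Type*} [Finite β] {f : β → L.BoundedFormula α n}
    (h : ∀ i, (f i).IsQF) : (BoundedFormula.iInf f).IsQF := by
  have key : ∀ l : List β, ((l.map f).foldr (· ⊓ ·) ⊤).IsQF := fun l => by
    induction l with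
    | nil => exact BoundedFormula.IsQF.top
    | cons i l ih => exact (h i).inf ih
  exact key _

theorem exists_isQF_alls {n : ℕ} {φ : L.BoundedFormula α n} (h : φ.IsUniversal) :
    ∃ (m : ℕ) (ψ : L.BoundedFormula α m), ψ.IsQF ∧ φ.alls = ψ.alls := by
  induction h with
  | of_isQF h => exact ⟨_, _, h, rfl⟩
  | all _ ih => exact ih

/-- A universal theory holds in a structure if it holds in the finitely generated substructures. -/
theorem models_of_forall_fg {T : L.Theory} [T.IsUniversal] {M : Type*} [L.Structure M]
    (h : ∀ S : L.Substructure M, S.FG → S ⊨ T) : M ⊨ T := by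
  refine ⟨fun φ hφ => ?_⟩
  obtain ⟨m, ψ, hψ, hφψ⟩ := exists_isQF_alls (Theory.IsUniversal.isUniversal_of_mem hφ)
  change φ = ψ.alls at hφψ
  rw [hφψ, Sentence.Realize, BoundedFormula.realize_alls]
  intro xs
  let S := Substructure.closure L (Set.range xs)
  have hS := (h S (Substructure.fg_closure (Set.finite_range xs))).realize_of_mem φ hφ
  rw [hφψ, Sentence.Realize, BoundedFormula.realize_alls] at hS
  have := hS fun i => ⟨xs i, Substructure.subset_closure ⟨i, rfl⟩⟩
  rw [← hψ.realize_embedding S.subtype] at this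
  rwa [Subsingleton.elim (S.subtype ∘ default) default] at this

end Universal

section TreeSyntax

variable {L : FirstOrder.Language.{u, v}}

theorem isQF_le {n : ℕ} (s t : (treeLanguage L).Term (Empty ⊕ Fin n)) : (s.le t).IsQF :=
  Relations.isQF _ _

theorem isQF_lt {n : ℕ} (s t : (treeLanguage L).Term (Empty ⊕ Fin n)) : (s.lt t).IsQF :=
  (isQF_le s t).inf (isQF_le t s).not

theorem isQF_star {m n : ℕ} (R : L.Relations n) (x : (treeLanguage L).Term (Empty ⊕ Fin m))
    (y : Fin n → (treeLanguage L).Term (Empty ⊕ Fin m)) : (star R x y).IsQF :=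
  Relations.isQF _ _

theorem isQF_starFormula [L.IsRelational] {n : ℕ} {ψ : L.BoundedFormula Empty n} (h : ψ.IsQF) :
    (starFormula ψ).IsQF := by
  induction h with
  | falsum => exact BoundedFormula.isQF_bot
  | of_isAtomic h =>
    cases h with
    | equal s t => exact isQF_lt _ _
    | rel R ts => exact isQF_star _ _ _
  | imp _ _ ih₁ ih₂ => exact ih₁.imp ih₂

instance universalTreeTheory_isUniversal [L.IsRelational] (T₀ : L.Theory) :
    (universalTreeTheory T₀).IsUniversal := by
  refine ⟨fun φ hφ => ?_⟩
  rcases hφ with ((hφ | hφ) | ⟨n, R, rfl | rfl⟩) | ⟨n, ψ, hψ, -, rfl⟩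
  · exact Theory.IsUniversal.isUniversal_of_mem hφ
  · rcases hφ with rfl | rfl | rfl
    · exact .all (.all (.all (.of_isQF (((isQF_le _ _).inf (isQF_le _ _)).imp
        ((isQF_le _ _).sup (isQF_le _ _))))))
    · exact .all (.all (.of_isQF ((isQF_le _ _).inf (isQF_le _ _))))
    · exact .all (.all (.all (.of_isQF (((isQF_le _ _).inf (isQF_le _ _)).imp (isQF_le _ _)))))
  · exact isUniversal_alls (.of_isQF (((isQF_star _ _ _).inf (isQF_iInf fun _ => isQF_lt _ _)).imp
      (isQF_star _ _ _)))
  · exact isUniversal_alls (.of_isQF ((isQF_star _ _ _).imp (isQF_iInf fun _ => isQF_lt _ _)))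
  · exact isUniversal_alls (.of_isQF ((isQF_iInf fun _ => isQF_lt _ _).imp (isQF_starFormula hψ)))

/-! ### Models of the theory of trees -/

/-- The symbols `≤` and `∧` have their meaning in the semilattice `N`. -/
class IsTreeStructure (L : FirstOrder.Language.{u, v}) (N : Type w) [SemilatticeInf N]
    [(treeLanguage L).Structure N] : Prop extends (treeLanguage L).OrderedStructure N where
  funMap_meet : ∀ x : Fin 2 → N, Structure.funMap (meetSymb L) x = x 0 ⊓ x 1

section Semantics

variable {N : Type w} [(treeLanguage L).Structure N]

theorem realize_star {m n : ℕ} (R : L.Relations n) (x : (treeLanguage L).Term (Empty ⊕ Fin m))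
    (y : Fin n → (treeLanguage L).Term (Empty ⊕ Fin m)) (v : Empty → N) (xs : Fin m → N) :
    (star R x y).Realize v xs ↔ Structure.RelMap (starSymb R)
      (Fin.cons (x.realize (Sum.elim v xs)) fun i => (y i).realize (Sum.elim v xs) :
        Fin (n + 1) → N) := by
  rw [star, BoundedFormula.realize_rel]
  refine iff_of_eq (congrArg _ (funext fun i => ?_))
  refine Fin.cases ?_ (fun i => ?_) i <;> simp

variable [SemilatticeInf N] [IsTreeStructure L N]

theorem realize_meet {α : Type} (s t : (treeLanguage L).Term α) (v : α → N) :
    (meet s t).realize v = s.realize v ⊓ t.realize v := by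
  rw [meet, Term.realize_functions_apply₂, IsTreeStructure.funMap_meet]
  rfl

theorem realize_linearBelow : N ⊨ linearBelow L ↔ ∀ x y z : N, y ≤ x → z ≤ x → y ≤ z ∨ z ≤ y := by
  simp only [linearBelow, Sentence.Realize, Formula.Realize, BoundedFormula.realize_all,
    BoundedFormula.realize_imp, BoundedFormula.realize_inf, BoundedFormula.realize_sup,
    Term.realize_le, and_imp]
  rfl

theorem models_meetTreeTheory (h : ∀ x y z : N, y ≤ x → z ≤ x → y ≤ z ∨ z ≤ y) :
    N ⊨ meetTreeTheory L := by
  refine Theory.model_union_iff.2 ⟨inferInstance, ⟨fun φ hφ => ?_⟩⟩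
  rcases hφ with rfl | rfl | rfl
  · exact realize_linearBelow.2 h
  · simp [meetLower, Sentence.Realize, Formula.Realize, realize_meet]
  · simp only [meetGreatest, Sentence.Realize, Formula.Realize, BoundedFormula.realize_all,
      BoundedFormula.realize_imp, BoundedFormula.realize_inf,
      Term.realize_le, and_imp, realize_meet]
    exact fun x y z => le_inf

theorem realize_axiomWD {n : ℕ} (R : L.Relations n) :
    N ⊨ axiomWD R ↔ ∀ (x : N) (y y' : Fin n → N),
      Structure.RelMap (starSymb R) (Fin.cons x y : Fin (n + 1) → N) → (∀ i, x < y i ⊓ y' i) →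
        Structure.RelMap (starSymb R) (Fin.cons x y' : Fin (n + 1) → N) := by
  simp only [axiomWD, Sentence.Realize, Function.comp_apply, BoundedFormula.realize_alls,
    BoundedFormula.realize_imp, BoundedFormula.realize_inf, BoundedFormula.realize_iInf,
    realize_star, Term.realize_lt, realize_meet, Term.realize_var, Sum.elim_inr, and_imp]
  constructor
  · intro h x y y'
    simpa only [Fin.cons_zero, Fin.cons_succ, Fin.append_left, Fin.append_right] using
      h (Fin.cons x (Fin.append y y'))
  · intro h xs
    exact h _ _ _

theorem realize_axiomOC {n : ℕ} (R : L.Relations n) :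
    N ⊨ axiomOC R ↔ ∀ (x : N) (y : Fin n → N),
      Structure.RelMap (starSymb R) (Fin.cons x y : Fin (n + 1) → N) → ∀ i, x < y i := by
  simp only [axiomOC, Sentence.Realize, Function.comp_apply, BoundedFormula.realize_alls,
    BoundedFormula.realize_imp, BoundedFormula.realize_iInf,
    realize_star, Term.realize_lt, Term.realize_var, Sum.elim_inr]
  constructor
  · intro h x y
    simpa using h (Fin.cons x y)
  · intro h xs
    exact h _ _

theorem realize_axiomT [L.IsRelational] {n : ℕ} (ψ : L.BoundedFormula Empty n) :
    N ⊨ axiomT ψ ↔ ∀ (x : N) (y : Fin n → N), (∀ i, x < y i) →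
      (starFormula ψ).Realize default (Fin.cons x y : Fin (n + 1) → N) := by
  simp only [axiomT, Sentence.Realize, Function.comp_apply, BoundedFormula.realize_alls,
    BoundedFormula.realize_imp, BoundedFormula.realize_iInf,
    Term.realize_lt, Term.realize_var, Sum.elim_inr]
  constructor
  · intro h x y hxy
    exact h (Fin.cons x y) (by simpa using hxy)
  · intro h xs hxs
    have := h (xs 0) (Fin.tail xs) hxs
    rwa [Fin.cons_self_tail] at this

/-- The formula `ψ*(x, y)` expresses that `ψ` holds of the open cones of the `y i` above `x`. -/
theorem realize_starFormula [L.IsRelational] {Q : Type*} [L.Structure Q] {n : ℕ} {x : N}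
    {y : Fin n → N} {q : Fin n → Q} (heq : ∀ i j, x < y i ⊓ y j ↔ q i = q j)
    (hrel : ∀ {k : ℕ} (R : L.Relations k) (f : Fin k → Fin n),
      Structure.RelMap (starSymb R) (Fin.cons x fun i => y (f i) : Fin (k + 1) → N) ↔
        Structure.RelMap R fun i => q (f i))
    {ψ : L.BoundedFormula Empty n} (hψ : ψ.IsQF) :
    (starFormula ψ).Realize default (Fin.cons x y : Fin (n + 1) → N) ↔ ψ.Realize default q := by
  have hterm : ∀ t : L.Term (Empty ⊕ Fin n), ∃ i : Fin n,
      (starTerm t).realize (Sum.elim default (Fin.cons x y : Fin (n + 1) → N)) = y i ∧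
        t.realize (Sum.elim default q) = q i := by
    rintro ((e | i) | ⟨f, _⟩)
    · exact e.elim
    · exact ⟨i, by simp [starTerm], rfl⟩
    · exact isEmptyElim f
  choose τ hτ hτ' using hterm
  induction hψ with
  | falsum => exact Iff.rfl
  | of_isAtomic h =>
    cases h with
    | equal s t =>
      refine Iff.trans ?_ ((heq (τ s) (τ t)).trans ?_)
      · rw [← hτ, ← hτ]
        simp [starFormula, Term.bdEqual, realize_meet]
      · rw [BoundedFormula.realize_bdEqual, hτ', hτ']
    | rel R ts =>
      refine Iff.trans ?_ ((hrel R fun i => τ (ts i)).trans ?_)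
      · simp only [← hτ]
        simp [starFormula, Relations.boundedFormula, realize_star]
      · simp only [← hτ']
        rfl
  | imp _ _ ih₁ ih₂ => exact imp_congr ih₁ ih₂

end Semantics

end TreeSyntax

section Models

variable {L : FirstOrder.Language.{u, v}}

theorem exists_isTreeStructure {M : Type w} [(treeLanguage L).Structure M]
    (h : M ⊨ meetTreeTheory L) : ∃ _ : SemilatticeInf M, IsTreeStructure L M := by
  have h₁ : M ⊨ (treeLanguage L).partialOrderTheory := h.mono Set.subset_union_left
  let _ := (treeLanguage L).partialOrderOfModels M
  have hmeet : ∀ s t : (treeLanguage L).Term (Empty ⊕ Fin 2), ∀ v : Empty ⊕ Fin 2 → M,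
      (meet s t).realize v = Structure.funMap (meetSymb L) ![s.realize v, t.realize v] :=
    fun s t v => Term.realize_functions_apply₂
  have hmeet' : ∀ s t : (treeLanguage L).Term (Empty ⊕ Fin 3), ∀ v : Empty ⊕ Fin 3 → M,
      (meet s t).realize v = Structure.funMap (meetSymb L) ![s.realize v, t.realize v] :=
    fun s t v => Term.realize_functions_apply₂
  have hlower : M ⊨ meetLower L := h.realize_of_mem _ (by simp [meetTreeTheory])
  have hgreatest : M ⊨ meetGreatest L := h.realize_of_mem _ (by simp [meetTreeTheory])
  simp only [meetLower, Sentence.Realize, Formula.Realize, BoundedFormula.realize_all,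
    BoundedFormula.realize_inf, Term.realize_le, hmeet] at hlower
  simp only [meetGreatest, Sentence.Realize, Formula.Realize, BoundedFormula.realize_all,
    BoundedFormula.realize_imp, BoundedFormula.realize_inf, Term.realize_le, hmeet',
    and_imp] at hgreatest
  let I : SemilatticeInf M := { (treeLanguage L).partialOrderOfModels M with
    inf := fun x y => Structure.funMap (meetSymb L) ![x, y]
    inf_le_left := fun x y => (hlower x y).1
    inf_le_right := fun x y => (hlower x y).2
    le_inf := fun x y z hy hz => hgreatest y z x hy hz }
  refine ⟨I, ⟨fun x => ?_⟩⟩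
  exact congrArg _ (funext fun i => by fin_cases i <;> rfl)

/-- The meet-tree underlying a model, with the relations `R*`. -/
def coneTree [L.IsRelational] {T₀ : L.Theory} {M : Type w} [SemilatticeInf M]
    [(treeLanguage L).Structure M] [IsTreeStructure L M] (h : M ⊨ universalTreeTheory T₀) :
    ConeTree L M where
  le_or_le := fun {x y z} => realize_linearBelow.1
    (h.realize_of_mem _ (Or.inl (Or.inl (Or.inr (Or.inl rfl))))) x y z
  rel R x y := Structure.RelMap (starSymb R) (Fin.cons x y : Fin (_ + 1) → M)
  rel_congr := fun {n R x y y'} => (realize_axiomWD R).1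
    (h.realize_of_mem _ (Or.inl (Or.inr ⟨n, R, Or.inl rfl⟩))) x y y'
  lt_of_rel := fun {n R x y} => (realize_axiomOC R).1
    (h.realize_of_mem _ (Or.inl (Or.inr ⟨n, R, Or.inr rfl⟩))) x y

end Models

/-! ### Open cones of a center -/

namespace ConeTree

variable {L : FirstOrder.Language.{u, v}} {M : Type w} [SemilatticeInf M] (𝒯 : ConeTree L M)

/-- Two elements above `g` are in the same open cone of center `g` if their meet is above `g`. -/
def openConeSetoid (g : M) : Setoid {y : M // g < y} where
  r y z := g < y.1 ⊓ z.1
  iseqv :=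
    { refl := fun y => by simpa using y.2
      symm := fun {y z} h => by rwa [inf_comm]
      trans := fun {y z w} h h' => by
        rcases 𝒯.le_or_le (inf_le_right : y.1 ⊓ z.1 ≤ z.1) (inf_le_left : z.1 ⊓ w.1 ≤ z.1) with
          h1 | h1
        · exact h.trans_le (le_inf inf_le_left (h1.trans inf_le_right))
        · exact h'.trans_le (le_inf (h1.trans inf_le_left) inf_le_right) }

/-- The set of open cones of center `g`. -/
def OpenCones (g : M) : Type w :=
  Quotient (𝒯.openConeSetoid g)

/-- The open cone of center `g` that contains `y`. -/
def cone {g : M} (y : {y : M // g < y}) : 𝒯.OpenCones g :=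
  Quotient.mk (𝒯.openConeSetoid g) y

/-- An element of an open cone. -/
noncomputable def point {g : M} (q : 𝒯.OpenCones g) : {y : M // g < y} :=
  Quotient.out q

theorem cone_eq_iff {g : M} {y z : {y : M // g < y}} :
    𝒯.cone y = 𝒯.cone z ↔ g < y.1 ⊓ z.1 :=
  Quotient.eq (r := 𝒯.openConeSetoid g)

theorem cone_point {g : M} (q : 𝒯.OpenCones g) : 𝒯.cone (𝒯.point q) = q :=
  Quotient.out_eq q

noncomputable instance [L.IsRelational] (g : M) : L.Structure (𝒯.OpenCones g) where
  RelMap R q := 𝒯.rel R g fun i => (𝒯.point (q i)).1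

theorem relMap_cone [L.IsRelational] {g : M} {n : ℕ} (R : L.Relations n)
    (y : Fin n → {y : M // g < y}) :
    Structure.RelMap R (fun i => 𝒯.cone (y i)) ↔ 𝒯.rel R g fun i => (y i).1 := by
  have h : ∀ i, g < (𝒯.point (𝒯.cone (y i))).1 ⊓ (y i).1 := fun i =>
    𝒯.cone_eq_iff.1 (𝒯.cone_point _)
  exact ⟨fun hR => 𝒯.rel_congr hR h, fun hR => 𝒯.rel_congr hR fun i => inf_comm (y i).1 _ ▸ h i⟩

theorem openCones_models [L.IsRelational] {T₀ : L.Theory} [T₀.IsUniversal]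
    [(treeLanguage L).Structure M] [IsTreeStructure L M] (h : M ⊨ universalTreeTheory T₀) (g : M) :
    (coneTree h).OpenCones g ⊨ T₀ := by
  refine ⟨fun φ hφ => ?_⟩
  obtain ⟨m, ψ, hψ, hφψ⟩ := exists_isQF_alls (Theory.IsUniversal.isUniversal_of_mem hφ)
  change φ = ψ.alls at hφψ
  rw [hφψ, Sentence.Realize, BoundedFormula.realize_alls]
  intro q
  have h1 := (realize_axiomT ψ).1 (h.realize_of_mem _ (Or.inr ⟨m, ψ, hψ, hφψ ▸ hφ, rfl⟩)) g
    (fun i => ((coneTree h).point (q i)).1) fun i => ((coneTree h).point (q i)).2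
  refine (realize_starFormula (fun i j => ?_) (fun R f => Iff.rfl) hψ).1 h1
  rw [← (coneTree h).cone_eq_iff, cone_point, cone_point]

end ConeTree

/-! ### Few relations at a center -/

section Traces

variable {L : FirstOrder.Language.{u, v}}

/-- In the model completion, a formula without the independence property shatters only sequences of
bounded length, and quantifier-free formulas are absolute between models of `T₀` and their
extensions to models of `T`. -/
theorem exists_not_formulaShatters {T₀ T : L.Theory} (hT : IsModelCompletion T₀ T) (h : IsNIP T)
    {m n : ℕ} {φ : L.Formula (Fin m ⊕ Fin n)} (hφ : BoundedFormula.IsQF φ) :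
    ∃ D, ∀ (Q : Type w) [L.Structure Q] [Nonempty Q] [Small.{max u v} Q], Q ⊨ T₀ →
      ¬ FormulaShatters φ Q D := by
  by_contra! hcon
  refine h m n φ (formulaHasIP_of_forall_formulaShatters φ fun D => ?_)
  obtain ⟨Q, _, _, _, hQ, hD⟩ := hcon D
  let Q' : Theory.ModelType.{u, v, max u v} T₀ := (Theory.ModelType.of T₀ Q).shrink
  obtain ⟨N, ⟨f⟩⟩ := hT.exists_embedding Q'
  let e : Q ≃[L] Q' := (equivShrink Q).inducedStructureEquiv
  refine ⟨N, hD.map (f.comp e.toEmbedding) fun d => ?_⟩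
  have := hφ.realize_embedding (f.comp e.toEmbedding) (v := d) (xs := default)
  rw [Formula.Realize, Formula.Realize, ← this]
  exact iff_of_eq (congrArg _ (Subsingleton.elim _ _))

/-- The atomic formula `R(z)` where `z i` is the parameter variable if `P i` holds, and otherwise
the `i`-th object variable. -/
def mixFormula {n : ℕ} (R : L.Relations n) (P : Fin n → Bool) : L.Formula (Fin n ⊕ Fin 1) :=
  R.formula fun i => if P i then Term.var (Sum.inr 0) else Term.var (Sum.inl i)

theorem realize_mixFormula {n : ℕ} (R : L.Relations n) (P : Fin n → Bool) {Q : Type*}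
    [L.Structure Q] (a : Fin n → Q) (b : Fin 1 → Q) :
    (mixFormula R P).Realize (Sum.elim a b) ↔
      Structure.RelMap R fun i => if P i then b 0 else a i := by
  rw [mixFormula, Formula.realize_rel]
  refine iff_of_eq (congrArg _ (funext fun i => ?_))
  split_ifs <;> rfl

/-- The Sauer–Shelah lemma, applied to the traces at the center `g`: shattering by elements of the
tree is shattering in the structure of open cones. -/
theorem ConeTree.atMostClasses_traces [L.IsRelational] {M : Type w} [SemilatticeInf M]
    (𝒯 : ConeTree L M) {n : ℕ} (R : L.Relations n) (P : Fin n → Bool) {D : ℕ} (g : M)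
    (hD : Nonempty (𝒯.OpenCones g) → ¬ FormulaShatters (mixFormula R P) (𝒯.OpenCones g) D)
    {ι : Type} [Fintype ι] (e : ι → M) :
    AtMostClasses (fun b b' => ∀ y : Fin n → ι,
        𝒯.rel R g (fun m => if P m then b else e (y m)) ↔
          𝒯.rel R g fun m => if P m then b' else e (y m)) ((Fintype.card ι ^ n + 1) ^ D) := by
  classical
  by_cases hP : ∃ m, P m
  swap
  · push Not at hP
    refine ⟨fun _ => ⟨0, Nat.pow_pos (Nat.succ_pos _)⟩, fun b b' _ y => ?_⟩
    simp [hP]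
  obtain ⟨m₀, hm₀⟩ := hP
  have := AtMostClasses.of_not_shatters
    (fun (b : M) => {y : Fin n → ι | 𝒯.rel R g fun m => if P m then b else e (y m)}) D ?_
  · refine this.mono (fun b b' h y => ?_) (by simp)
    exact iff_of_eq (congrArg (fun s => y ∈ s) h)
  intro S hS
  by_contra hcard
  push Not at hcard
  -- One shattered tuple is sacrificed to make sure that the shattering elements lie above `g`.
  obtain ⟨y₀, hy₀⟩ : S.Nonempty := Finset.card_pos.1 (by omega)
  obtain ⟨S', hS', hS'card⟩ := Finset.exists_subset_card_eq
    (show D ≤ (S.erase y₀).card by rw [Finset.card_erase_of_mem hy₀]; omega)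
  let a : Fin D → Fin n → ι := fun i => ((S'.equivFinOfCardEq hS'card).symm i).1
  have ha : ∀ i, a i ∈ S.erase y₀ := fun i => hS' ((S'.equivFinOfCardEq hS'card).symm i).2
  have hainj : Function.Injective a := fun i j hij =>
    (S'.equivFinOfCardEq hS'card).symm.injective (Subtype.ext hij)
  have hb : ∀ s : Set (Fin D), ∃ b, (∀ m, P m → g < b) ∧
      ∀ i, 𝒯.rel R g (fun m => if P m then b else e (a i m)) ↔ i ∈ s := by
    intro s
    obtain ⟨b, hb⟩ := hS (insert y₀ (Finset.univ.image a |>.filter fun y => ∃ i ∈ s, a i = y)) (by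
      intro y hy
      simp only [Finset.mem_insert, Finset.mem_filter, Finset.mem_image, Finset.mem_univ,
        true_and] at hy
      rcases hy with rfl | ⟨⟨i, rfl⟩, -⟩
      · exact hy₀
      · exact Finset.mem_of_mem_erase (ha i))
    refine ⟨b, fun m hm => ?_, fun i => ?_⟩
    · have h1 := (hb y₀ hy₀).2 (Finset.mem_insert_self _ _)
      simpa [hm] using 𝒯.lt_of_rel h1 m
    · refine (hb (a i) (Finset.mem_of_mem_erase (ha i))).trans ?_
      simp only [Finset.mem_insert, Finset.mem_filter, Finset.mem_image, Finset.mem_univ,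
        true_and, hainj.eq_iff, exists_eq_right, exists_eq, (Finset.ne_of_mem_erase (ha i)),
        false_or]
  choose b hbg hbs using hb
  have hne : Nonempty (𝒯.OpenCones g) := ⟨𝒯.cone ⟨b ∅, hbg ∅ m₀ hm₀⟩⟩
  have hag : ∀ i m, ¬ P m → g < e (a i m) := fun i m hm => by
    have h1 := (hbs Set.univ i).2 (Set.mem_univ i)
    simpa [hm] using 𝒯.lt_of_rel h1 m
  let cl : M → 𝒯.OpenCones g := fun y =>
    if hy : g < y then 𝒯.cone ⟨y, hy⟩ else Classical.arbitrary _
  refine hD hne ⟨fun i m => cl (e (a i m)), fun s => ⟨fun _ => cl (b s), fun i => ?_⟩⟩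
  rw [realize_mixFormula, ← hbs s i]
  have hlt : ∀ m, g < if P m then b s else e (a i m) := fun m => by
    split_ifs with hm
    · exact hbg s m hm
    · exact hag i m hm
  rw [← 𝒯.relMap_cone R fun m => ⟨_, hlt m⟩]
  refine iff_of_eq (congrArg _ (funext fun m => ?_))
  by_cases hm : P m
  · have := hbg s m hm
    simp [hm, cl, this]
  · have := hag i m hm
    simp [hm, cl, this]

end Traces

/-! ### Automorphisms from equality of atomic formulas -/

namespace ConeTree

variable {L : FirstOrder.Language.{u, v}} {M : Type w} [SemilatticeInf M] (𝒯 : ConeTree L M)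

/-- The elements `a ⊓ b`, `a ⊓ c`, `a ⊓ d` are comparable, so that the least of them is the meet of
all four elements. -/
theorem inf_inf_inf_eq (𝒯 : ConeTree L M) (a b c d : M) :
    a ⊓ b ⊓ (c ⊓ d) = a ⊓ b ∨ a ⊓ b ⊓ (c ⊓ d) = a ⊓ c ∨ a ⊓ b ⊓ (c ⊓ d) = a ⊓ d := by
  have key : ∀ y z, a ⊓ y ⊓ (a ⊓ z) = a ⊓ y ∨ a ⊓ y ⊓ (a ⊓ z) = a ⊓ z := fun y z =>
    (𝒯.le_or_le (inf_le_left : a ⊓ y ≤ a) (inf_le_left : a ⊓ z ≤ a)).imp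
      inf_eq_left.2 inf_eq_right.2
  have h : a ⊓ b ⊓ (c ⊓ d) = a ⊓ b ⊓ (a ⊓ c) ⊓ (a ⊓ d) := by
    refine le_antisymm (le_inf (le_inf inf_le_left (le_inf ?_ ?_)) (le_inf ?_ ?_))
      (le_inf (inf_le_left.trans inf_le_left) (le_inf ?_ ?_))
    · exact inf_le_left.trans inf_le_left
    · exact inf_le_right.trans inf_le_left
    · exact inf_le_left.trans inf_le_left
    · exact inf_le_right.trans inf_le_right
    · exact (inf_le_left.trans inf_le_right).trans inf_le_right
    · exact inf_le_right.trans inf_le_right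
  rw [h]
  rcases key b c with h1 | h1 <;> rw [h1]
  · rcases key b d with h2 | h2 <;> rw [h2] <;> tauto
  · rcases key c d with h2 | h2 <;> rw [h2] <;> tauto

namespace SameAtoms

variable {𝒯} {V : Type*} {d d' : V → M}

theorem symm (h : 𝒯.SameAtoms d d') : 𝒯.SameAtoms d' d :=
  ⟨fun i j k => (h.inf_le_iff i j k).symm, fun R i j f => (h.rel_iff R i j f).symm⟩

theorem inf_le_inf_iff (h : 𝒯.SameAtoms d d') (i j k l : V) :
    d i ⊓ d j ≤ d k ⊓ d l ↔ d' i ⊓ d' j ≤ d' k ⊓ d' l := by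
  rw [_root_.le_inf_iff, _root_.le_inf_iff, h.inf_le_iff, h.inf_le_iff]

theorem inf_eq_inf_iff (h : 𝒯.SameAtoms d d') (i j k l : V) :
    d i ⊓ d j = d k ⊓ d l ↔ d' i ⊓ d' j = d' k ⊓ d' l := by
  rw [le_antisymm_iff, le_antisymm_iff, h.inf_le_inf_iff, h.inf_le_inf_iff]

theorem inf_inf_eq (h : 𝒯.SameAtoms d d') {i j k l p q : V}
    (heq : d i ⊓ d j ⊓ (d k ⊓ d l) = d p ⊓ d q) :
    d' i ⊓ d' j ⊓ (d' k ⊓ d' l) = d' p ⊓ d' q := by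
  refine le_antisymm ?_ (le_inf (le_inf ?_ ?_) (le_inf ?_ ?_))
  · have hle : ∀ x, d' i ⊓ d' j ⊓ (d' k ⊓ d' l) = d' i ⊓ d' x →
        d' i ⊓ d' j ⊓ (d' k ⊓ d' l) ≤ d' p ⊓ d' q := by
      intro x hx
      rw [hx, ← h.inf_le_inf_iff, ← heq]
      refine le_inf (le_inf inf_le_left ?_) (le_inf ?_ ?_) <;> rw [h.inf_le_iff, ← hx]
      · exact inf_le_left.trans inf_le_right
      · exact inf_le_right.trans inf_le_left
      · exact inf_le_right.trans inf_le_right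
    rcases 𝒯.inf_inf_inf_eq (d' i) (d' j) (d' k) (d' l) with hx | hx | hx <;> exact hle _ hx
  · rw [← h.inf_le_iff, ← heq]
    exact inf_le_left.trans inf_le_left
  · rw [← h.inf_le_iff, ← heq]
    exact inf_le_left.trans inf_le_right
  · rw [← h.inf_le_iff, ← heq]
    exact inf_le_right.trans inf_le_left
  · rw [← h.inf_le_iff, ← heq]
    exact inf_le_right.trans inf_le_right

theorem rel_inf_of_rel_inf (h : 𝒯.SameAtoms d d') {n : ℕ} {R : L.Relations n} {i j : V}
    {f f' : Fin n → V} (hR : 𝒯.rel R (d i ⊓ d j) fun m => d (f m) ⊓ d (f' m)) :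
    𝒯.rel R (d' i ⊓ d' j) fun m => d' (f m) ⊓ d' (f' m) := by
  have hlt : ∀ m, d' i ⊓ d' j < d' (f m) ⊓ d' (f' m) := fun m => by
    have := 𝒯.lt_of_rel hR m
    rw [lt_iff_le_not_ge] at this ⊢
    rwa [← h.inf_le_inf_iff, ← h.inf_le_inf_iff]
  have h1 : 𝒯.rel R (d i ⊓ d j) fun m => d (f m) :=
    𝒯.rel_congr hR fun m => (𝒯.lt_of_rel hR m).trans_le (le_inf le_rfl inf_le_left)
  exact 𝒯.rel_congr ((h.rel_iff R i j f).1 h1) fun m =>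
    (hlt m).trans_le (le_inf inf_le_left le_rfl)

end SameAtoms

end ConeTree

section Automorphism

variable {L : FirstOrder.Language.{u, v}} [L.IsRelational] {T₀ : L.Theory} {M : Type w}
  [SemilatticeInf M] [(treeLanguage L).Structure M] [IsTreeStructure L M]

/-- In an ultrahomogeneous tree, tuples that satisfy the same atomic formulas are conjugate: the map
`d i ⊓ d j ↦ d' i ⊓ d' j` is an isomorphism between the substructures they generate. -/
theorem ConeTree.SameAtoms.exists_automorphism (hM : IsUltrahomogeneous (treeLanguage L) M)
    (h : M ⊨ universalTreeTheory T₀) {V : Type*} [Finite V] {d d' : V → M}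
    (hd : (coneTree h).SameAtoms d d') : ∃ σ : M ≃[treeLanguage L] M, ∀ i, σ (d i) = d' i := by
  let S : (treeLanguage L).Substructure M :=
    { carrier := Set.range fun p : V × V => d p.1 ⊓ d p.2
      fun_mem := by
        rintro _ ⟨⟩ x hx
        obtain ⟨⟨i, j⟩, h0⟩ := hx 0
        obtain ⟨⟨k, l⟩, h1⟩ := hx 1
        have heq : Structure.funMap (meetSymb L) x = d i ⊓ d j ⊓ (d k ⊓ d l) := by
          rw [IsTreeStructure.funMap_meet, ← h0, ← h1]
        rcases (coneTree h).inf_inf_inf_eq (d i) (d j) (d k) (d l) with h2 | h2 | h2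
        · exact ⟨(i, j), (heq.trans h2).symm⟩
        · exact ⟨(i, k), (heq.trans h2).symm⟩
        · exact ⟨(i, l), (heq.trans h2).symm⟩ }
  have hmem : ∀ z : S, ∃ p : V × V, d p.1 ⊓ d p.2 = z := fun z => z.2
  choose p hp using hmem
  have hle : ∀ z w : S, (z : M) ≤ w ↔
      d' (p z).1 ⊓ d' (p z).2 ≤ d' (p w).1 ⊓ d' (p w).2 := fun z w => by
    rw [← hp z, ← hp w, hd.inf_le_inf_iff]
  let f : S ↪[treeLanguage L] M :=
    { toFun := fun z => d' (p z).1 ⊓ d' (p z).2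
      inj' := fun z w hzw => Subtype.ext (le_antisymm ((hle z w).2 hzw.le) ((hle w z).2 hzw.ge))
      map_fun' := by
        rintro _ ⟨⟩ x
        change _ = Structure.funMap (meetSymb L) _
        rw [IsTreeStructure.funMap_meet]
        refine (hd.inf_inf_eq ?_).symm
        rw [hp, hp, hp]
        exact (IsTreeStructure.funMap_meet (L := L) fun i => (x i : M)).symm
      map_rel' := by
        rintro _ (⟨⟩ | R) x
        · refine (relMap_leSymb _).trans (Iff.trans (hle (x 0) (x 1)).symm ?_)
          exact (relMap_leSymb (L := treeLanguage L) fun i => (x i : M)).symm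
        · have h1 : ∀ y : Fin (_ + 1) → M, Structure.RelMap (starSymb R) y ↔
              (coneTree h).rel R (y 0) (Fin.tail y) := fun y => by
            change _ ↔ Structure.RelMap (starSymb R) (Fin.cons (y 0) (Fin.tail y))
            rw [Fin.cons_self_tail]
          refine (h1 _).trans (Iff.trans ?_ (h1 fun i => (x i : M)).symm)
          refine Iff.trans ?_ (iff_of_eq (congrArg₂ ((coneTree h).rel R) (hp (x 0))
            (funext fun m => hp (x m.succ))))
          exact ⟨fun hR => hd.symm.rel_inf_of_rel_inf hR, fun hR => hd.rel_inf_of_rel_inf hR⟩ }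
  have : Finite S := Set.finite_range _
  obtain ⟨σ, hσ⟩ := hM S Substructure.FG.of_finite f
  refine ⟨σ, fun i => ?_⟩
  let z : S := ⟨d i, ⟨(i, i), inf_idem _⟩⟩
  have h1 : f z = σ (d i) := by
    rw [hσ]
    rfl
  rw [← h1]
  have h2 : d' (p z).1 ⊓ d' (p z).2 = d' i ⊓ d' i :=
    (hd.inf_eq_inf_iff _ _ _ _).1 ((hp z).trans (inf_idem _).symm)
  exact h2.trans (inf_idem _)

end Automorphism

/-! ### The orbits of an ultrahomogeneous tree -/

section TreeOrbits

variable {L : FirstOrder.Language.{u, v}} [L.IsRelational]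

/-- Elements that satisfy the same atomic formulas over `E` are conjugate over `E`, so that the
orbits are counted by `ConeTree.exists_polyBounded_sameAtoms`. -/
theorem exists_hasPolyOrbits [Finite (Σ n, L.Relations n)] {T₀ T : L.Theory} [T₀.IsUniversal]
    (hT : IsModelCompletion T₀ T) (hNIP : IsNIP T) {M : Type} [(treeLanguage L).Structure M]
    (hM : IsUltrahomogeneous (treeLanguage L) M) (h : M ⊨ universalTreeTheory T₀) :
    ∃ k, HasPolyOrbits (treeLanguage L) M k := by
  classical
  obtain ⟨_, _⟩ := exists_isTreeStructure (h.mono fun φ hφ => Or.inl (Or.inl hφ))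
  have hqf : ∀ (R : Σ n, L.Relations n) (P : Fin R.1 → Bool),
      BoundedFormula.IsQF (mixFormula R.2 P) := fun R P => Relations.isQF _ _
  choose D hD using fun (R : Σ n, L.Relations n) (P : Fin R.1 → Bool) =>
    exists_not_formulaShatters.{u, v, 0} hT hNIP (hqf R P)
  obtain ⟨f, hf, hcount⟩ := (coneTree h).exists_polyBounded_sameAtoms
    (t := fun R n => (n ^ R.1 + 1) ^ ∑ P, D R P)
    (fun R => ((PolyBounded.id.pow _).add_one).pow _)
    (fun R P ι _ e g => ((coneTree h).atMostClasses_traces R.2 P g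
      (fun hne => hD R P _ (ConeTree.openCones_models h g)) e).mono (fun _ _ h => h)
      (Nat.pow_le_pow_right (Nat.succ_pos _)
        (Finset.single_le_sum (fun _ _ => Nat.zero_le _) (Finset.mem_univ P))))
  obtain ⟨C, k, hC⟩ := hf.comp_affine 1 1
  refine ⟨k, C, fun E => ?_⟩
  rcases isEmpty_or_nonempty M with hM | ⟨⟨x₀⟩⟩
  · exact ⟨fun x => hM.elim x, fun x => hM.elim x⟩
  -- An additional entry makes sure that the tuple is not empty.
  · let e : Option E → M := fun o => o.elim x₀ fun z => z
    refine (hcount (Option E) e).mono (fun b b' hbb' => ?_) ?_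
    · obtain ⟨σ, hσ⟩ := hbb'.exists_automorphism hM h
      exact ⟨σ, fun x hx => hσ (some (some ⟨x, hx⟩)), fun _ => hσ none⟩
    · have := hC E.card
      simpa using this

/-- Finitely generated substructures of `M` are in its age, hence models of the universal theory. -/
theorem models_universalTreeTheory_of_isFraisseLimit {T₀ : L.Theory} {M : Type w}
    [(treeLanguage L).Structure M] [Countable M]
    (hM : IsFraisseLimit (finiteModels (universalTreeTheory T₀)) M) :
    M ⊨ universalTreeTheory T₀ :=
  models_of_forall_fg fun S hS => by
    have : Bundled.mk (S : Type w) ∈ (treeLanguage L).age M := age.fg_substructure hS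
    rw [hM.age] at this
    exact this.2

end TreeOrbits

/-! ### The tree with one center -/

/-- The tree with a root and the elements of `F` as leaves. The root is `none`. -/
def StarTree (F : Type w) : Type w :=
  Option F

namespace StarTree

variable {F : Type w}

/-- The root of the tree. -/
def root : StarTree F := none

/-- The leaf given by an element of `F`. -/
def leaf (q : F) : StarTree F := some q

theorem leaf_injective : Function.Injective (leaf : F → StarTree F) :=
  Option.some_injective F

theorem eq_root_or_leaf (x : StarTree F) : x = root ∨ ∃ q, x = leaf q := by
  rcases x with _ | q
  · exact Or.inl rfl
  · exact Or.inr ⟨q, rfl⟩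

theorem leaf_ne_root (q : F) : leaf q ≠ root :=
  Option.some_ne_none q

open Classical in
noncomputable instance : SemilatticeInf (StarTree F) where
  le x y := x = root ∨ x = y
  le_refl x := Or.inr rfl
  le_trans x y z := by
    rintro (rfl | rfl) h
    · exact Or.inl rfl
    · exact h
  le_antisymm x y := by
    rintro (rfl | rfl) (h | h)
    · exact h.symm
    · exact h.symm
    · rfl
    · rfl
  inf x y := if x = y then x else root
  inf_le_left x y := by
    by_cases h : x = y
    · exact Or.inr (if_pos h)
    · exact Or.inl (if_neg h)
  inf_le_right x y := by
    by_cases h : x = y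
    · exact Or.inr ((if_pos h).trans h)
    · exact Or.inl (if_neg h)
  le_inf x y z := by
    rintro (rfl | rfl) h
    · exact Or.inl rfl
    · rcases h with rfl | rfl
      · exact Or.inl rfl
      · exact Or.inr (if_pos rfl).symm

theorem le_def {x y : StarTree F} : x ≤ y ↔ x = root ∨ x = y :=
  Iff.rfl

theorem lt_def {x y : StarTree F} : x < y ↔ x = root ∧ y ≠ root := by
  rw [lt_iff_le_and_ne, le_def]
  constructor
  · rintro ⟨rfl | h, hne⟩
    · exact ⟨rfl, hne.symm⟩
    · exact (hne h).elim
  · rintro ⟨rfl, h⟩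
    exact ⟨Or.inl rfl, h.symm⟩

theorem root_lt_leaf (q : F) : (root : StarTree F) < leaf q :=
  lt_def.2 ⟨rfl, leaf_ne_root q⟩

theorem root_lt_inf_iff {x y : StarTree F} : root < x ⊓ y ↔ x = y ∧ x ≠ root := by
  classical
  rw [lt_def]
  by_cases h : x = y
  · subst h
    simp
  · have : x ⊓ y = root := if_neg h
    simp [h, this]

variable {L : FirstOrder.Language.{u, v}} [L.Structure F]

/-- The relations of `F` are put on the leaves, with the root as their center. A relation without
arguments gets the same truth value at all elements of the tree. -/
noncomputable instance : (treeLanguage L).Structure (StarTree F) where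
  funMap := fun
    | .meet, x => x 0 ⊓ x 1
  RelMap := fun
    | .le, x => x 0 ≤ x 1
    | .star R, x => ∃ q, Structure.RelMap R q ∧ ∀ i, x 0 < x i.succ ∧ x i.succ = leaf (q i)

instance : IsTreeStructure L (StarTree F) where
  relMap_leSymb _ := Iff.rfl
  funMap_meet _ := rfl

theorem relMap_star {n : ℕ} (R : L.Relations n) (x : StarTree F) (y : Fin n → StarTree F) :
    Structure.RelMap (starSymb R) (Fin.cons x y : Fin (n + 1) → StarTree F) ↔
      ∃ q, Structure.RelMap R q ∧ ∀ i, x < y i ∧ y i = leaf (q i) :=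
  Iff.rfl

theorem relMap_star_leaf {n : ℕ} (R : L.Relations n) {x : StarTree F} (q : Fin n → F)
    (hx : ∀ i, x < leaf (q i)) :
    Structure.RelMap (starSymb R) (Fin.cons x fun i => leaf (q i) : Fin (n + 1) → StarTree F) ↔
      Structure.RelMap R q := by
  rw [relMap_star]
  constructor
  · rintro ⟨q', hq', h⟩
    rwa [show q = q' from funext fun i => leaf_injective (h i).2]
  · exact fun h => ⟨q, h, fun i => ⟨hx i, rfl⟩⟩

theorem models_universalTreeTheory [L.IsRelational] {T₀ : L.Theory} (hF : F ⊨ T₀) :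
    StarTree F ⊨ universalTreeTheory T₀ := by
  refine ⟨fun φ hφ => ?_⟩
  rcases hφ with (hφ | ⟨n, R, rfl | rfl⟩) | ⟨n, ψ, hψ, hψT, rfl⟩
  · refine (models_meetTreeTheory fun x y z hy hz => ?_).realize_of_mem φ hφ
    rcases hy with rfl | rfl
    · exact Or.inl (Or.inl rfl)
    · exact Or.inr hz
  · rw [realize_axiomWD]
    rintro x y y' ⟨q, hq, h⟩ hlt
    refine ⟨q, hq, fun i => ?_⟩
    have h1 := hlt i
    rw [(lt_def.1 h1).1] at h1
    have h2 : y i = y' i := (root_lt_inf_iff.1 h1).1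
    simpa only [Fin.cons_zero, Fin.cons_succ, h2] using h i
  · rw [realize_axiomOC]
    rintro x y ⟨q, hq, h⟩ i
    exact (h i).1
  · rw [realize_axiomT]
    intro x y hxy
    have hleaf : ∀ i, ∃ q, y i = leaf q := fun i =>
      (eq_root_or_leaf (y i)).resolve_left (lt_def.1 (hxy i)).2
    choose q hq using hleaf
    have h1 := hF.realize_of_mem _ hψT
    rw [Sentence.Realize, BoundedFormula.realize_alls] at h1
    refine (realize_starFormula (q := q) (fun i j => ?_) (fun R f => ?_) hψ).2 (h1 q)
    · have hx := (lt_def.1 (hxy i)).1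
      rw [hx, root_lt_inf_iff, hq, hq, leaf_injective.eq_iff]
      exact and_iff_left (leaf_ne_root _)
    · simp only [hq] at hxy ⊢
      exact relMap_star_leaf R _ fun i => hxy _

end StarTree

/-! ### The independence property on the open cones of a center -/

section Converse

variable {L : FirstOrder.Language.{u, v}} [L.IsRelational]

/-- In a model of the model completion, the truth value of a formula depends only on the
quantifier-free type of a tuple, because this type determines the substructure on the tuple. -/
theorem IsModelCompletion.realize_iff {T₀ T : L.Theory} [T₀.IsUniversal]
    (hT : IsModelCompletion T₀ T) (N : Theory.ModelType.{u, v, max u v} T) {V : Type*}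
    (φ : L.Formula V) {d d' : V → N} (heq : ∀ i j, d i = d j ↔ d' i = d' j)
    (hrel : ∀ {n : ℕ} (R : L.Relations n) (f : Fin n → V),
      (Structure.RelMap R fun i => d (f i)) ↔ Structure.RelMap R fun i => d' (f i)) :
    φ.Realize d ↔ φ.Realize d' := by
  rcases isEmpty_or_nonempty V with hV | hV
  · rw [Subsingleton.elim d d']
  have hN : N ⊨ T₀ := ⟨fun ψ hψ => (hT.extends_base ψ hψ).realize_sentence N⟩
  let S : L.Substructure N :=
    { carrier := Set.range d
      fun_mem := fun f => isEmptyElim f }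
  have : Nonempty S := ⟨⟨d hV.some, ⟨_, rfl⟩⟩⟩
  let S' : Theory.ModelType.{u, v, max u v} T₀ := Theory.ModelType.of T₀ S
  have hmem : ∀ z : S, ∃ i, d i = z := fun z => z.2
  choose p hp using hmem
  let f : S ↪[L] N :=
    { toFun := fun z => d' (p z)
      inj' := fun z w h => Subtype.ext (by rw [← hp z, ← hp w]; exact (heq _ _).2 h)
      map_fun' := fun f => isEmptyElim f
      map_rel' := fun R x => by
        have h1 : (fun i => (x i : N)) = fun i => d (p (x i)) := funext fun i => (hp _).symm
        refine (hrel R fun i => p (x i)).symm.trans ?_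
        rw [← h1]
        rfl }
  have h := hT.complete_diagram S' N N S.subtype f (φ.relabel fun i => (⟨d i, ⟨i, rfl⟩⟩ : S))
  have h2 : (f : S → N) ∘ (fun i => (⟨d i, ⟨i, rfl⟩⟩ : S)) = d' :=
    funext fun i => (heq _ _).1 (hp ⟨d i, ⟨i, rfl⟩⟩)
  refine (Formula.realize_relabel.symm.trans h).trans ((Formula.realize_relabel (M := N)).trans ?_)
  exact iff_of_eq (congrArg φ.Realize h2)

/-- A formula with the independence property in `T` is turned into one with the independence
property in the tree: the finite substructures that witness it become sets of leaves above a common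
root, and the root is used as an additional parameter. -/
theorem isNIP_of_isNIP_completeTheory [Finite (Σ n, L.Relations n)] {T₀ T : L.Theory}
    [T₀.IsUniversal] (hT : IsModelCompletion T₀ T) {M : Type} [(treeLanguage L).Structure M]
    [Countable M] (hM : IsFraisseLimit (finiteModels (universalTreeTheory T₀)) M)
    (h : IsNIP ((treeLanguage L).completeTheory M)) : IsNIP T := by
  classical
  rintro m n φ ⟨N, a, hφ⟩
  choose b hb using hφ
  have hN : N ⊨ T₀ := ⟨fun ψ hψ => (hT.extends_base ψ hψ).realize_sentence N⟩
  let V := Fin m ⊕ Fin n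
  -- The atomic formulas, and the corresponding formulas in the tree.
  let J := (Σ R : Σ n, L.Relations n, Fin R.1 → V) ⊕ (V × V)
  let atoms : (V → N) → J → Prop := fun d => Sum.elim
    (fun j => Structure.RelMap j.1.2 fun i => d (j.2 i)) fun j => d j.1 = d j.2
  let em : V → Fin m ⊕ Fin (n + 1) := Sum.map id Fin.succ
  let θ : J → (treeLanguage L).Formula (Fin m ⊕ Fin (n + 1)) := Sum.elim
    (fun j => (starSymb j.1.2).formula
      (Fin.cons (Term.var (Sum.inr 0)) fun i => Term.var (em (j.2 i))))
    fun j => Term.equal (Term.var (em j.1)) (Term.var (em j.2))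
  let 𝒮 : Set (J → Prop) := {σ | ∃ (i : ℕ) (s : Set ℕ), i ∈ s ∧ σ = atoms (Sum.elim (a i) (b s))}
  have h𝒮 : ∀ i s, atoms (Sum.elim (a i) (b s)) ∈ 𝒮 ↔ i ∈ s := by
    intro i s
    refine ⟨?_, fun his => ⟨i, s, his, rfl⟩⟩
    rintro ⟨i', s', his', heq⟩
    rw [← hb s i]
    rw [← hb s' i'] at his'
    refine (hT.realize_iff N φ (fun k l => ?_) fun {k} R f => ?_).2 his'
    · exact iff_of_eq (congrFun heq (Sum.inr (k, l)))
    · exact iff_of_eq (congrFun heq (Sum.inl ⟨⟨k, R⟩, f⟩))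
  obtain ⟨φ', hφ'⟩ := exists_formula_of_truth_values.{0, v, 0} θ 𝒮
  have hshatter : ∀ D, Nonempty M ∧ FormulaShatters φ' M D := by
    intro D
    let I := (Fin D × Fin m) ⊕ (Set (Fin D) × Fin n)
    let c : I → N := Sum.elim (fun p => a p.1 p.2) fun p => b (Fin.val '' p.1) p.2
    obtain ⟨k, ⟨r⟩⟩ := Finite.exists_equiv_fin (Set.range c)
    let j : Fin k → N := fun x => (r.symm x : N)
    have hj : Function.Injective j := Subtype.val_injective.comp r.symm.injective
    let _ : L.Structure (Fin k) :=
      { funMap := fun f => isEmptyElim f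
        RelMap := fun R x => Structure.RelMap R fun i => j (x i) }
    let f : Fin k ↪[L] N :=
      { toFun := j
        inj' := hj
        map_fun' := fun f => isEmptyElim f
        map_rel' := fun _ _ => Iff.rfl }
    have hF : Fin k ⊨ T₀ := Theory.IsUniversal.models_of_embedding f
    have hmem : (Bundled.mk (StarTree (Fin k)) : Bundled.{0} (treeLanguage L).Structure) ∈
        (treeLanguage L).age M := by
      rw [hM.age]
      exact ⟨inferInstanceAs (Finite (Option (Fin k))), StarTree.models_universalTreeTheory hF⟩
    obtain ⟨g⟩ := hmem.2
    let c' : I → Fin k := fun i => r ⟨c i, ⟨i, rfl⟩⟩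
    have hc' : ∀ i, j (c' i) = c i := fun i => by simp [j, c']
    refine ⟨⟨g StarTree.root⟩, fun i l => g (StarTree.leaf (c' (Sum.inl (i, l)))), fun s =>
      ⟨Fin.cons (g StarTree.root) fun l => g (StarTree.leaf (c' (Sum.inr (s, l)))), fun i => ?_⟩⟩
    rw [hφ' M, ← Fin.val_injective.mem_set_image (s := s), ← h𝒮]
    refine iff_of_eq (congrArg (fun σ => σ ∈ 𝒮) (funext fun x => propext ?_))
    let ρ : V → I := Sum.map (fun l => (i, l)) fun l => (s, l)
    have hρ : ∀ l, c (ρ l) = Sum.elim (a i) (b (Fin.val '' s)) l := by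
      rintro (l | l) <;> rfl
    have hval : ∀ l, (Sum.elim (fun l => g (StarTree.leaf (c' (Sum.inl (i, l)))))
        (Fin.cons (g StarTree.root) fun l => g (StarTree.leaf (c' (Sum.inr (s, l)))) :
          Fin (n + 1) → M)) (em l) = g (StarTree.leaf (c' (ρ l))) := by
      rintro (l | l) <;> rfl
    rcases x with ⟨⟨k', R⟩, q⟩ | ⟨l, l'⟩
    · simp only [θ, atoms, Sum.elim_inl, Formula.realize_rel]
      refine Iff.trans (iff_of_eq (congrArg _ (funext fun y => ?_)))
        ((g.map_rel (starSymb R) (Fin.cons StarTree.root fun y =>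
          StarTree.leaf (c' (ρ (q y))))).trans
            ((StarTree.relMap_star_leaf R _ fun y => StarTree.root_lt_leaf _).trans
              (iff_of_eq (congrArg (Structure.RelMap R) (funext fun y =>
                (hc' (ρ (q y))).trans (hρ (q y)))))))
      refine Fin.cases ?_ (fun y => ?_) y
      · rfl
      · exact hval (q y)
    · simp only [θ, atoms, Sum.elim_inr, Formula.realize_equal, Term.realize_var, hval]
      rw [g.injective.eq_iff, StarTree.leaf_injective.eq_iff, ← hj.eq_iff, hc', hc', hρ, hρ]
  refine h m (n + 1) φ' (formulaHasIP_of_forall_formulaShatters φ' fun D => ?_)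
  obtain ⟨_, hD⟩ := hshatter D
  exact ⟨Theory.ModelType.shrink.{0, v, 0, v}
    (Theory.ModelType.of ((treeLanguage L).completeTheory M) M),
    hD.map (equivShrink.{v} M).inducedStructureEquiv fun d =>
      StrongHomClass.realize_formula _ φ'⟩

end Converse

end OpenConeTree

open OpenConeTree

theorem mainTheorem6 {L : FirstOrder.Language.{u, v}} [L.IsRelational] [Finite (Σ n, L.Relations n)]
    (T₀ : L.Theory) [T₀.IsUniversal]
    (hT₀ : OpenConeTree.IsStrongFraisse
      (OpenConeTree.finiteModels T₀ : Set (Bundled.{0} L.Structure)))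
    (T : L.Theory) (hT : OpenConeTree.IsModelCompletion T₀ T)
    (M : Type) [(OpenConeTree.treeLanguage L).Structure M] [Countable M]
    (hM : IsFraisseLimit (OpenConeTree.finiteModels (OpenConeTree.universalTreeTheory T₀)) M) :
    (OpenConeTree.IsNIP ((OpenConeTree.treeLanguage L).completeTheory M) ↔
      OpenConeTree.IsNIP T) ∧
    (OpenConeTree.IsNIP T →
      OpenConeTree.HasFiniteDpRank ((OpenConeTree.treeLanguage L).completeTheory M)) := by
  have horbits : IsNIP T → ∃ k, HasPolyOrbits (treeLanguage L) M k := fun h =>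
    exists_hasPolyOrbits hT h hM.ultrahomogeneous (models_universalTreeTheory_of_isFraisseLimit hM)
  refine ⟨⟨isNIP_of_isNIP_completeTheory hT hM, fun h => ?_⟩, fun h => ?_⟩
  · obtain ⟨k, hk⟩ := horbits h
    exact hk.isNIP
  · obtain ⟨k, hk⟩ := horbits h
    exact ⟨k + 1, hk.dpRankLT⟩
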